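/- Let $\Gamma$ be a simplicial graph with vertex set $V$ (possibly infinite), let $(G_u)_{u\in V}$ be a family of groups, and let $\Gamma\mathcal G$ be the graph product, i.e. the quotient of the free product $\ast_{u\in V} G_u$ by the normal subgroup generated by the commutators $ghg^{-1}h^{-1}$ with $g\in G_u$, $h\in G_v$ and $\{u,v\}$ an edge of $\Gamma$. For a family $x=(x_i)_{i\in I}$ of elements of a group $G$, indexed by a finite or countably infinite (effectively coded) alphabet $I$, say that *conjugacy is decidable over $x$* if there is an algorithm which, given two words in the letters $x_i^{\pm1}$, decides whether the elements of $G$ that they represent are conjugate in $G$. Say that $G$ *has solvable conjugacy problem* if conjugacy is decidable over every finite family of elements of $G$. (For finitely generated $G$ this is equivalent to decidability over one, or every, finite generating family, which is the usual definition.) 1. If every vertex group $G_u$ has solvable conjugacy problem, then the graph product $\Gamma\mathcal G$ has solvable conjugacy problem. 2. Suppose moreover that $V$ is finite, and let $I$ be a finite or countably infinite (effectively coded) alphabet. If every $G_u$ is equipped with a generating family $(x_{u,i})_{i\in I}$ over which conjugacy is decidable, then the family $(x_{u,i})_{(u,i)\in V\times I}$ generates $\Gamma\mathcal G$, and conjugacy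 is decidable over it. -/

import Mathlib

/-- The relators of the graph product, as elements of the free product of the vertex groups: the
commutators `g h g⁻¹ h⁻¹` where `g ∈ G u`, `h ∈ G v` and `u`, `v` are adjacent. -/
def graphProductRelators {V : Type*} (Γ : SimpleGraph V) (G : V → Type*) [∀ u, Group (G u)] :
    Set (Monoid.CoprodI G) :=
  {r | ∃ (u v : V) (g : G u) (h : G v), Γ.Adj u v ∧
    r = Monoid.CoprodI.of g * Monoid.CoprodI.of h * (Monoid.CoprodI.of g)⁻¹ *
      (Monoid.CoprodI.of h)⁻¹}

/-- The graph product of the family of groups `G` over the simplicial graph `Γ`. -/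
def GraphProduct {V : Type*} (Γ : SimpleGraph V) (G : V → Type*) [∀ u, Group (G u)] : Type _ :=
  Monoid.CoprodI G ⧸ Subgroup.normalClosure (graphProductRelators Γ G)

instance GraphProduct.instGroup {V : Type*} (Γ : SimpleGraph V) (G : V → Type*)
    [∀ u, Group (G u)] : Group (GraphProduct Γ G) :=
  inferInstanceAs
    (Group (Monoid.CoprodI G ⧸ Subgroup.normalClosure (graphProductRelators Γ G)))

/-- The canonical homomorphism from a vertex group to the graph product. -/
def GraphProduct.of {V : Type*} (Γ : SimpleGraph V) (G : V → Type*) [∀ u, Group (G u)] (u : V) :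
    G u →* GraphProduct Γ G :=
  (QuotientGroup.mk' (Subgroup.normalClosure (graphProductRelators Γ G))).comp
    (Monoid.CoprodI.of (M := G) (i := u))

/-- The element of `G` represented by a word in the letters `x i` (coded by `(i, true)`) and
`(x i)⁻¹` (coded by `(i, false)`). -/
def wordValue {G : Type*} [Group G] {ι : Type*} (x : ι → G) (w : List (ι × Bool)) : G :=
  (w.map fun p => bif p.2 then x p.1 else (x p.1)⁻¹).prod

/-- There is an algorithm which, given two words in the letters `(x i)^{±1}`, decides whether
the elements that they represent are conjugate in `G`. -/
def ConjugacyDecidable {G : Type*} [Group G] {ι : Type*} [Primcodable ι] (x : ι → G) : Prop :=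
  ComputablePred fun p : List (ι × Bool) × List (ι × Bool) =>
    IsConj (wordValue x p.1) (wordValue x p.2)

/-- The family `x` generates `G` and the conjugacy problem of `G` is solvable for words written
over `x`. The alphabet `ι` is finite or countably infinite. -/
def SolvableConjugacyProblemWrt {G : Type*} [Group G] {ι : Type*} [Primcodable ι] (x : ι → G) :
    Prop :=
  Subgroup.closure (Set.range x) = ⊤ ∧ ConjugacyDecidable x

/-- The group `G` has solvable conjugacy problem: for every finite family of elements of `G`,
conjugacy in `G` of words written over that family can be decided by an algorithm. For finitely
generated `G` this is the same as deciding conjugacy of words over one finite generating family,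
see `hasSolvableConjugacyProblem_iff` below. -/
def HasSolvableConjugacyProblem (G : Type*) [Group G] : Prop :=
  ∀ (n : ℕ) (x : Fin n → G), ConjugacyDecidable x

theorem wordValue_append {G : Type*} [Group G] {ι : Type*} (x : ι → G)
    (w w' : List (ι × Bool)) : wordValue x (w ++ w') = wordValue x w * wordValue x w' := by
  simp [wordValue]

theorem exists_word {G : Type*} [Group G] {ι : Type*} (x : ι → G) {g : G}
    (hg : g ∈ Subgroup.closure (Set.range x)) : ∃ w, wordValue x w = g := by
  classical
  have key : ∀ F : FreeGroup ι, wordValue x F.toWord = FreeGroup.lift x F := by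
    intro F
    conv_rhs => rw [← FreeGroup.mk_toWord (x := F)]
    rw [FreeGroup.lift_mk]
    rfl
  rw [← FreeGroup.range_lift_eq_closure] at hg
  obtain ⟨F, rfl⟩ := hg
  exact ⟨_, key F⟩

theorem ConjugacyDecidable.of_subset {G : Type*} [Group G] {ι κ : Type*} [Primcodable ι]
    [Primcodable κ] [Finite κ] {y : ι → G} (hy : ConjugacyDecidable y) (x : κ → G)
    (hx : ∀ k, x k ∈ Subgroup.closure (Set.range y)) : ConjugacyDecidable x := by
  have h : ∀ p : κ × Bool, ∃ w, wordValue y w = bif p.2 then x p.1 else (x p.1)⁻¹ := by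
    rintro ⟨k, b⟩
    apply exists_word
    cases b
    · exact inv_mem (hx k)
    · exact hx k
  choose f hf using h
  have hprim : Primrec fun w : List (κ × Bool) => w.flatMap f :=
    Primrec.list_flatMap Primrec.id ((Primrec.dom_finite f).comp Primrec.snd)
  have hval : ∀ w : List (κ × Bool), wordValue y (w.flatMap f) = wordValue x w := by
    intro w
    induction w with
    | nil => rfl
    | cons p w ih =>
      rw [List.flatMap_cons, wordValue_append, ih, hf]
      simp [wordValue]
  refine ComputablePred.computable_of_manyOneReducible ?_ hy
  refine ⟨fun p => (p.1.flatMap f, p.2.flatMap f),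
    ((hprim.comp Primrec.fst).pair (hprim.comp Primrec.snd)).to_comp, fun p => ?_⟩
  simp only [hval]

/-- For a group with a finite generating family, solvability of the conjugacy problem is the
decidability of conjugacy for words over that family, whichever it is. -/
theorem hasSolvableConjugacyProblem_iff {G : Type*} [Group G] {ι : Type*} [Finite ι]
    [Primcodable ι] (x : ι → G) (hx : Subgroup.closure (Set.range x) = ⊤) :
    HasSolvableConjugacyProblem G ↔ SolvableConjugacyProblemWrt x := by
  constructor
  · intro h
    refine ⟨hx, ?_⟩
    obtain ⟨n, ⟨e⟩⟩ := Finite.exists_equiv_fin ι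
    refine (h n (x ∘ e.symm)).of_subset x fun k => Subgroup.subset_closure ⟨e k, by simp⟩
  · rintro ⟨-, h⟩ n y
    exact h.of_subset y fun k => by simp [hx]

/-! Conjugacy is read as rewriting of cyclic words of syllables. Rotations, swaps of commuting
syllables, and conjugations of a syllable commuting with all others preserve length and generate
`CycEqv`; merges and deletions shorten a word by one syllable. A reduction survives every move
(`CycRed.exists_of_cycEqv`), so it acts on classes, and two reductions of one word are closed up by
at most one further reduction on each side (`CycRed.cycJoin`). The conjugation move is forced by one
overlap: if everything else commutes with two syllables `a`, `b` at the same vertex, the cycle can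
be merged to `a * b` or to `b * a`. By Church–Rosser, having a common descendant is an equivalence
relation. It contains the defining relations in every context as well as rotations, hence conjugacy
(`cycConj_of_isConj`). So irreducible cyclic words representing conjugate elements differ by moves
alone (`CycConj.cycEqv`). The decision procedure searches for a certificate. Programs of rotations,
swaps, merges and deletions act on coded words. Conjugation moves, which range over possibly
infinite groups, are left out and absorbed into the comparison: a syllable commuting with all others
is compared up to conjugacy in its vertex group, the rest up to equality. Orbits under rotations and
swaps are finite, so a finite closed list of irreducible words containing no match refutes
conjugacy, while a match proves it; one of the two always exists (`exists_certificate`). For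
infinite `V`, a finite family involves finitely many syllables, hence finitely many vertices. The
rewriting takes place in the whole graph product, so no retraction onto a subgraph is needed. -/

namespace GraphProduct

open Relation List

/-! ### Cyclic words: moves, reductions, and their compatibility -/

section CyclicWords

variable {V : Type*} (Γ : SimpleGraph V) {G : V → Type*} [∀ u, Group (G u)]

/-- Elementary length-preserving moves on cyclic words of syllables: rotation, transposition of two
commuting syllables, and conjugation of a syllable that commutes with all the others. -/
inductive CycStep : List (Sigma G) → List (Sigma G) → Prop
  | rot {l l' : List (Sigma G)} (h : l ~r l') : CycStep l l'
  | swap (x y : Sigma G) (l : List (Sigma G)) (h : Γ.Adj x.1 y.1) :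
      CycStep (x :: y :: l) (y :: x :: l)
  | conj (u : V) (s a : G u) (l : List (Sigma G)) (h : ∀ y ∈ l, Γ.Adj u y.1) :
      CycStep (⟨u, a⟩ :: l) (⟨u, s * a * s⁻¹⟩ :: l)

/-- Equivalence of cyclic words under length-preserving moves. -/
def CycEqv : List (Sigma G) → List (Sigma G) → Prop := EqvGen (CycStep Γ)

/-- Reductions of cyclic words: two syllables at the same vertex, separated by syllables commuting
with them, are merged, or a trivial syllable is deleted. -/
inductive CycRed : List (Sigma G) → List (Sigma G) → Prop
  | merge {l : List (Sigma G)} {u : V} {a b : G u} {m q : List (Sigma G)}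
      (h : l ~r ⟨u, a⟩ :: (m ++ ⟨u, b⟩ :: q)) (hm : ∀ y ∈ m, Γ.Adj u y.1) :
      CycRed l (⟨u, a * b⟩ :: (m ++ q))
  | del {l : List (Sigma G)} {u : V} {l' : List (Sigma G)} (h : l ~r ⟨u, 1⟩ :: l') :
      CycRed l l'

theorem isRotated_of_eq_append {α : Type*} {l l' : List α} (s t : List α) (h : l = s ++ t)
    (h' : l' = t ++ s) : l ~r l' := by
  subst h h'; exact isRotated_append

theorem exists_append_of_isRotated {α : Type*} {l l' : List α} (h : l ~r l') :
    ∃ s t, l = s ++ t ∧ l' = t ++ s := by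
  obtain ⟨n, hn, rfl⟩ := isRotated_iff_mod.1 h
  exact ⟨l.take n, l.drop n, by simp, by rw [rotate_eq_drop_append_take hn]⟩

/-- Moves act at the head of a list, whereas a reduction may start anywhere on the cycle. This case
split, with its two-syllable version below, locates the one relative to the other. -/
theorem cons_isRotated_cons_cases {α : Type*} {x d : α} {l D : List α} (h : (x :: l) ~r (d :: D)) :
    (d = x ∧ D = l) ∨ ∃ s t, D = s ++ x :: t ∧ l = t ++ d :: s := by
  obtain ⟨t, s, h₁, h₂⟩ := exists_append_of_isRotated h
  rcases t with _ | ⟨x', t⟩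
  · left
    rw [append_nil, ← nil_append s, ← h₁] at h₂
    simpa using h₂
  · rcases s with _ | ⟨d', s⟩
    · simp_all
    · right
      simp only [cons_append, cons.injEq] at h₁ h₂
      obtain ⟨rfl, rfl⟩ := h₁
      obtain ⟨rfl, rfl⟩ := h₂
      exact ⟨s, t, rfl, rfl⟩

theorem cons_cons_isRotated_cons_cases {α : Type*} {x y d : α} {l D : List α}
    (h : (x :: y :: l) ~r (d :: D)) :
    (d = x ∧ D = y :: l) ∨ (d = y ∧ D = l ++ [x]) ∨
      ∃ s t, D = s ++ x :: y :: t ∧ l = t ++ d :: s := by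
  rcases cons_isRotated_cons_cases h with h | ⟨s, t, h₁, h₂⟩
  · exact .inl h
  · right
    rcases t with _ | ⟨y', t⟩
    · simp only [nil_append, cons.injEq] at h₂
      obtain ⟨rfl, rfl⟩ := h₂
      exact .inl ⟨rfl, h₁⟩
    · simp only [cons_append, cons.injEq] at h₂
      obtain ⟨rfl, rfl⟩ := h₂
      exact .inr ⟨s, t, h₁, rfl⟩

theorem append_cons_eq_append_cons_cases {α : Type*} {m q s t : List α} {b x : α}
    (h : m ++ b :: q = s ++ x :: t) :
    (∃ c, m = s ++ x :: c ∧ t = c ++ b :: q) ∨ (m = s ∧ b = x ∧ q = t) ∨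
      ∃ c, s = m ++ b :: c ∧ q = c ++ x :: t := by
  rcases append_eq_append_iff.1 h with ⟨c, h₁, h₂⟩ | ⟨c, h₁, h₂⟩ <;> rcases c with _ | ⟨z, c⟩ <;>
    simp_all

variable {Γ}

theorem CycStep.symm {l l' : List (Sigma G)} (h : CycStep Γ l l') : CycStep Γ l' l := by
  cases h with
  | rot h => exact .rot h.symm
  | swap x y l h => exact .swap y x l h.symm
  | conj u s a l h =>
    simpa [mul_assoc] using CycStep.conj (Γ := Γ) u s⁻¹ (s * a * s⁻¹) l h

theorem CycStep.eqv {l l' : List (Sigma G)} (h : CycStep Γ l l') : CycEqv Γ l l' := .rel _ _ h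

@[refl] theorem CycEqv.refl (l : List (Sigma G)) : CycEqv Γ l l := EqvGen.refl _

theorem CycEqv.symm {l l' : List (Sigma G)} (h : CycEqv Γ l l') : CycEqv Γ l' l :=
  EqvGen.symm _ _ h

theorem CycEqv.trans {l l' l'' : List (Sigma G)} (h : CycEqv Γ l l') (h' : CycEqv Γ l' l'') :
    CycEqv Γ l l'' := EqvGen.trans _ _ _ h h'

theorem CycEqv.of_isRotated {l l' : List (Sigma G)} (h : l ~r l') : CycEqv Γ l l' :=
  (CycStep.rot h).eqv

theorem CycEqv.append_comm (s t : List (Sigma G)) : CycEqv Γ (s ++ t) (t ++ s) :=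
  .of_isRotated isRotated_append

theorem CycEqv.swap (p q : List (Sigma G)) {x y : Sigma G} (h : Γ.Adj x.1 y.1) :
    CycEqv Γ (p ++ x :: y :: q) (p ++ y :: x :: q) :=
  (CycEqv.append_comm p (x :: y :: q)).trans <| (CycStep.swap x y (q ++ p) h).eqv.trans <|
    CycEqv.append_comm (y :: x :: q) p

theorem CycEqv.move (p m q : List (Sigma G)) {x : Sigma G} (h : ∀ y ∈ m, Γ.Adj x.1 y.1) :
    CycEqv Γ (p ++ x :: (m ++ q)) (p ++ (m ++ x :: q)) := by
  induction m generalizing p with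
  | nil => rfl
  | cons y m ih =>
    refine (CycEqv.swap p (m ++ q) (h y (by simp))).trans ?_
    simpa using ih (p ++ [y]) fun z hz => h z (by simp [hz])

theorem CycRed.of_isRotated {l l' r : List (Sigma G)} (h : CycRed Γ l r) (h' : l' ~r l) :
    CycRed Γ l' r := by
  cases h with
  | merge h hm => exact .merge (h'.trans h) hm
  | del h => exact .del (h'.trans h)

/-- The same reduction remains available after the swap: at most, one syllable enters or leaves the
gap `m` between the two merged syllables. The merged syllables cannot be the swapped pair itself,
since no vertex is adjacent to itself. -/
theorem CycRed.exists_of_swap {x y : Sigma G} {l r : List (Sigma G)} (hxy : Γ.Adj x.1 y.1)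
    (h : CycRed Γ (x :: y :: l) r) : ∃ r', CycRed Γ (y :: x :: l) r' ∧ CycEqv Γ r r' := by
  cases h with
  | @merge u a b m q hr hm =>
    rcases cons_cons_isRotated_cons_cases hr with ⟨rfl, h⟩ | ⟨rfl, h⟩ | ⟨s, t, h, rfl⟩
    · rcases m with _ | ⟨z, m⟩
      · simp only [nil_append, cons.injEq] at h
        obtain ⟨rfl, rfl⟩ := h
        exact absurd hxy (Γ.irrefl)
      · simp only [cons_append, cons.injEq] at h
        obtain ⟨rfl, rfl⟩ := h
        -- The first syllable of the gap jumps over `⟨u, a⟩` and so leaves the gap for the end of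
        -- the cyclic word.
        refine ⟨_, .merge (u := u) (a := a) (b := b) (m := m) (q := q ++ [z]) (isRotated_of_eq_append [z] _ rfl (by simp))
          fun y hy => hm y (by simp [hy]), ?_⟩
        exact (CycEqv.swap [] _ (by simpa using hxy)).trans
          (.of_isRotated (isRotated_of_eq_append [z] _ rfl (by simp)))
    · rcases eq_nil_or_concat q with rfl | ⟨q, z, rfl⟩
      · have := append_inj_right' h rfl
        simp only [cons.injEq, and_true] at this
        subst this
        exact absurd hxy (Γ.irrefl)
      · have h' : (m ++ ⟨u, b⟩ :: q) ++ [z] = l ++ [x] := by simpa using h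
        obtain ⟨rfl, h''⟩ := append_inj' h' rfl
        simp only [cons.injEq, and_true] at h''
        subst h''
        -- Here the cyclic predecessor of `⟨u, a⟩` enters the gap.
        refine ⟨_, .merge (u := u) (a := a) (b := b) (m := z :: m) (q := q) (by rfl) ?_, ?_⟩
        · simpa using ⟨hxy.symm, hm⟩
        · exact CycEqv.trans (.of_isRotated (isRotated_of_eq_append (⟨u, a * b⟩ :: (m ++ q)) [z]
            (by simp) rfl)) (CycEqv.swap [] _ hxy)
    · rcases append_cons_eq_append_cons_cases h with ⟨c, rfl, hc⟩ | ⟨rfl, rfl, rfl⟩ | ⟨c, rfl, rfl⟩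
      · rcases c with _ | ⟨z, c⟩
        · simp only [nil_append, cons.injEq] at hc
          obtain ⟨rfl, rfl⟩ := hc
          refine ⟨_, .merge (u := u) (a := a) (b := b) (m := s) (q := x :: t) (isRotated_of_eq_append
            (⟨u, b⟩ :: x :: t) (⟨u, a⟩ :: s) (by simp) (by simp)) (fun y hy => hm y (by simp [hy])),
            ?_⟩
          simp
          rfl
        · simp only [cons_append, cons.injEq] at hc
          obtain ⟨rfl, rfl⟩ := hc
          refine ⟨_, .merge (u := u) (a := a) (b := b) (m := s ++ y :: x :: c) (q := q) (isRotated_of_eq_append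
            (y :: x :: c ++ ⟨u, b⟩ :: q) (⟨u, a⟩ :: s) (by simp) (by simp))
            (fun y hy => hm y (by simp at hy ⊢; tauto)), ?_⟩
          simpa using CycEqv.swap (⟨u, a * b⟩ :: s) (c ++ q) hxy
      · refine ⟨_, .merge (u := u) (a := a) (b := b) (m := m ++ [y]) (q := t) (isRotated_of_eq_append
          (y :: ⟨u, b⟩ :: t) (⟨u, a⟩ :: m) (by simp) (by simp)) ?_, ?_⟩
        · intro z hz
          simp only [mem_append, mem_singleton] at hz
          rcases hz with hz | rfl
          · exact hm z hz
          · exact hxy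
        · simp
          rfl
      · refine ⟨_, .merge (u := u) (a := a) (b := b) (m := m) (q := c ++ y :: x :: t) (isRotated_of_eq_append
          (y :: x :: t) (⟨u, a⟩ :: (m ++ ⟨u, b⟩ :: c)) (by simp) (by simp)) hm, ?_⟩
        simpa using CycEqv.swap (⟨u, a * b⟩ :: (m ++ c)) t hxy
  | @del u _ hr =>
    rcases cons_cons_isRotated_cons_cases hr with ⟨rfl, rfl⟩ | ⟨rfl, rfl⟩ | ⟨s, t, rfl, rfl⟩
    · exact ⟨_, .del (isRotated_of_eq_append [y] _ rfl rfl), .append_comm [y] l⟩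
    · exact ⟨_, .del (by rfl), .append_comm l [x]⟩
    · exact ⟨_, .del (isRotated_of_eq_append (y :: x :: t) (⟨u, 1⟩ :: s) (by simp) rfl),
        .swap s t hxy⟩

/-- All other syllables lie at neighbours of `v`, hence none lies at `v`, and no merge can involve
the conjugated syllable. It is a bystander that still commutes with everything after the reduction,
or it is the deleted syllable, and then it stays trivial. -/
theorem CycRed.exists_of_conj {v : V} {s c : G v} {l r : List (Sigma G)}
    (hv : ∀ y ∈ l, Γ.Adj v y.1) (h : CycRed Γ (⟨v, c⟩ :: l) r) :
    ∃ r', CycRed Γ (⟨v, s * c * s⁻¹⟩ :: l) r' ∧ CycEqv Γ r r' := by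
  have key : ∀ p q : List (Sigma G), (∀ y ∈ p ++ q, Γ.Adj v y.1) →
      CycEqv Γ (p ++ ⟨v, c⟩ :: q) (p ++ ⟨v, s * c * s⁻¹⟩ :: q) := fun p q hpq =>
    (CycEqv.append_comm p (⟨v, c⟩ :: q)).trans <|
      (CycStep.conj v s c (q ++ p) fun y hy => hpq y (by simp at hy ⊢; tauto)).eqv.trans <|
      CycEqv.append_comm (⟨v, _⟩ :: q) p
  cases h with
  | @merge u a b m q hr hm =>
    rcases cons_isRotated_cons_cases hr with ⟨h, rfl⟩ | ⟨p, t, h, rfl⟩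
    · cases h
      exact absurd (hv ⟨v, b⟩ (by simp)) Γ.irrefl
    · have hvu : Γ.Adj v u := hv ⟨u, a⟩ (by simp)
      rcases append_cons_eq_append_cons_cases h with ⟨d, rfl, rfl⟩ | ⟨rfl, hb, rfl⟩ | ⟨d, rfl, rfl⟩
      · refine ⟨_, .merge (u := u) (a := a) (b := b) (m := p ++ ⟨v, s * c * s⁻¹⟩ :: d) (q := q) (isRotated_of_eq_append
          (⟨v, s * c * s⁻¹⟩ :: (d ++ ⟨u, b⟩ :: q)) (⟨u, a⟩ :: p) (by simp) (by simp)) ?_, ?_⟩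
        · intro y hy
          simp only [mem_append, mem_cons] at hy
          rcases hy with hy | rfl | hy
          · exact hm y (by simp [hy])
          · exact hvu.symm
          · exact hm y (by simp [hy])
        · have := key (⟨u, a * b⟩ :: p) (d ++ q) ?_
          · simpa using this
          · intro y hy
            simp only [mem_append, mem_cons] at hy
            rcases hy with (rfl | hy) | hy | hy
            · exact hvu
            all_goals exact hv y (by simp [hy])
      · cases hb
        exact absurd hvu Γ.irrefl
      · refine ⟨_, .merge (u := u) (a := a) (b := b) (m := m) (q := d ++ ⟨v, s * c * s⁻¹⟩ :: t) (isRotated_of_eq_append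
          (⟨v, s * c * s⁻¹⟩ :: t) (⟨u, a⟩ :: (m ++ ⟨u, b⟩ :: d)) (by simp) (by simp)) hm, ?_⟩
        have := key (⟨u, a * b⟩ :: (m ++ d)) t ?_
        · simpa using this
        · intro y hy
          simp only [mem_append, mem_cons] at hy
          rcases hy with (rfl | hy | hy) | hy
          · exact hvu
          all_goals exact hv y (by simp [hy])
  | @del u _ hr =>
    rcases cons_isRotated_cons_cases hr with ⟨h, rfl⟩ | ⟨p, t, rfl, rfl⟩
    · cases h
      exact ⟨_, .del (by simp; rfl), by rfl⟩
    · exact ⟨_, .del (isRotated_of_eq_append (⟨v, s * c * s⁻¹⟩ :: t) (⟨u, 1⟩ :: p) (by simp) rfl),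
        key p t fun y hy => hv y (by simp at hy ⊢; tauto)⟩

theorem CycRed.exists_of_cycStep {l l' r : List (Sigma G)} (h : CycStep Γ l l')
    (hr : CycRed Γ l r) : ∃ r', CycRed Γ l' r' ∧ CycEqv Γ r r' := by
  cases h with
  | rot h => exact ⟨r, hr.of_isRotated h.symm, by rfl⟩
  | swap x y l h => exact hr.exists_of_swap h
  | conj u s a l h => exact hr.exists_of_conj h

theorem CycRed.exists_of_cycEqv {l l' r : List (Sigma G)} (h : CycEqv Γ l l')
    (hr : CycRed Γ l r) : ∃ r', CycRed Γ l' r' ∧ CycEqv Γ r r' := by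
  -- Both directions are carried together so that the symmetry case of the induction closes.
  suffices ∀ r, (CycRed Γ l r → ∃ r', CycRed Γ l' r' ∧ CycEqv Γ r r') ∧
      (CycRed Γ l' r → ∃ r', CycRed Γ l r' ∧ CycEqv Γ r r') from (this r).1 hr
  clear hr r
  induction h with
  | rel l l' h => exact fun r => ⟨exists_of_cycStep h, exists_of_cycStep h.symm⟩
  | refl l => exact fun r => ⟨fun h => ⟨r, h, by rfl⟩, fun h => ⟨r, h, by rfl⟩⟩
  | symm l l' _ ih => exact fun r => (ih r).symm
  | trans l l' l'' _ _ ih₁ ih₂ =>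
    refine fun r => ⟨fun h => ?_, fun h => ?_⟩
    · obtain ⟨r', h', e⟩ := (ih₁ r).1 h
      obtain ⟨r'', h'', e'⟩ := (ih₂ r').1 h'
      exact ⟨r'', h'', e.trans e'⟩
    · obtain ⟨r', h', e⟩ := (ih₂ r).2 h
      obtain ⟨r'', h'', e'⟩ := (ih₁ r').2 h'
      exact ⟨r'', h'', e.trans e'⟩

end CyclicWords

end GraphProduct

/-! ### Confluence of cyclic reduction -/

namespace GraphProduct

open Relation List

section Confluence

variable {V : Type*} {Γ : SimpleGraph V} {G : V → Type*} [∀ u, Group (G u)]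

variable (Γ) in
/-- Two cyclic words are closed up by at most one reduction on each side. -/
def CycJoin (r s : List (Sigma G)) : Prop :=
  CycEqv Γ r s ∨ ∃ r' s', CycRed Γ r r' ∧ CycRed Γ s s' ∧ CycEqv Γ r' s'

theorem CycJoin.symm {r s : List (Sigma G)} (h : CycJoin Γ r s) : CycJoin Γ s r := by
  rcases h with h | ⟨r', s', hr, hs, e⟩
  · exact .inl h.symm
  · exact .inr ⟨s', r', hs, hr, e.symm⟩

theorem CycJoin.trans_eqv {r s t : List (Sigma G)} (h : CycJoin Γ r s) (e : CycEqv Γ s t) :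
    CycJoin Γ r t := by
  rcases h with h | ⟨r', s', hr, hs, e'⟩
  · exact .inl (h.trans e)
  · obtain ⟨t', ht, e''⟩ := hs.exists_of_cycEqv e
    exact .inr ⟨r', t', hr, ht, e'.trans e''⟩

/-- The critical pairs with a merge of two neighbouring syllables. Disjoint reductions commute,
three syllables at one vertex are settled by associativity, and merging the same pair the other way
round the cycle is settled by the conjugation move. -/
theorem CycRed.cycJoin_of_merge {u : V} {a b : G u} {l r : List (Sigma G)}
    (h : CycRed Γ (⟨u, a⟩ :: ⟨u, b⟩ :: l) r) : CycJoin Γ (⟨u, a * b⟩ :: l) r := by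
  cases h with
  | @merge v c d m q hr hm =>
    rcases cons_cons_isRotated_cons_cases hr with ⟨h₁, h⟩ | ⟨h₁, h⟩ | ⟨s, t, h, rfl⟩
    · cases h₁
      rcases m with _ | ⟨z, m⟩
      · simp only [nil_append, cons.injEq, Sigma.mk.injEq, heq_eq_eq, true_and] at h
        obtain ⟨rfl, rfl⟩ := h
        exact .inl (by rfl)
      · simp only [cons_append, cons.injEq] at h
        obtain ⟨rfl, rfl⟩ := h
        exact absurd (hm ⟨u, b⟩ (by simp)) Γ.irrefl
    · cases h₁
      rcases eq_nil_or_concat q with rfl | ⟨q, z, rfl⟩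
      · obtain ⟨rfl, h'⟩ := append_inj' h rfl
        simp only [cons.injEq, and_true, Sigma.mk.injEq, heq_eq_eq, true_and] at h'
        subst h'
        left
        -- The same two syllables are merged across the end of the cycle, giving `b * d` instead of
        -- `d * b`; these are conjugate by `d`, and every other syllable commutes with them.
        have := CycStep.conj (Γ := Γ) u d⁻¹ (d * b) m hm
        simpa [mul_assoc] using this.eqv
      · have h' : (m ++ ⟨u, d⟩ :: q) ++ [z] = l ++ [⟨u, a⟩] := by simpa using h
        obtain ⟨rfl, h''⟩ := append_inj' h' rfl
        simp only [cons.injEq, and_true] at h''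
        subst h''
        right
        refine ⟨_, _, .merge (u := u) (a := a * b) (b := d) (m := m) (q := q) (by rfl) hm,
          .merge (u := u) (a := a) (b := b * d) (m := []) (q := m ++ q)
          (isRotated_of_eq_append (⟨u, b * d⟩ :: (m ++ q)) [⟨u, a⟩] (by simp) (by simp)) (by simp),
          ?_⟩
        simp only [mul_assoc, nil_append]
        rfl
    · rcases append_cons_eq_append_cons_cases h with ⟨e, rfl, hc⟩ | ⟨rfl, hb, rfl⟩ | ⟨e, rfl, rfl⟩
      · rcases e with _ | ⟨z, e⟩
        · simp only [nil_append, cons.injEq] at hc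
          obtain ⟨hc, rfl⟩ := hc
          cases hc
          exact absurd (hm ⟨u, a⟩ (by simp)) Γ.irrefl
        · simp only [cons_append, cons.injEq] at hc
          obtain ⟨rfl, rfl⟩ := hc
          right
          refine ⟨_, _, .merge (u := v) (a := c) (b := d) (m := s ++ ⟨u, a * b⟩ :: e) (q := q)
            (isRotated_of_eq_append (⟨u, a * b⟩ :: (e ++ ⟨v, d⟩ :: q)) (⟨v, c⟩ :: s)
            (by simp) (by simp)) ?_,
            .merge (u := u) (a := a) (b := b) (m := []) (q := e ++ q ++ ⟨v, c * d⟩ :: s)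
            (isRotated_of_eq_append (⟨v, c * d⟩ :: s) (⟨u, a⟩ :: ⟨u, b⟩ :: (e ++ q))
            (by simp) (by simp)) (by simp), ?_⟩
          · intro y hy
            simp only [mem_append, mem_cons] at hy
            rcases hy with hy | rfl | hy
            · exact hm y (by simp [hy])
            · exact hm ⟨u, a⟩ (by simp)
            · exact hm y (by simp [hy])
          · exact .of_isRotated (isRotated_of_eq_append (⟨v, c * d⟩ :: s)
              (⟨u, a * b⟩ :: (e ++ q)) (by simp) (by simp))
      · cases hb
        right
        refine ⟨_, _, .merge (u := u) (a := c) (b := a * b) (m := m) (q := t)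
          (isRotated_of_eq_append (⟨u, a * b⟩ :: t) (⟨u, c⟩ :: m) (by simp) (by simp)) hm,
          .merge (u := u) (a := c * a) (b := b) (m := m) (q := t) (by rfl) hm, ?_⟩
        simp only [mul_assoc]
        rfl
      · right
        refine ⟨_, _, .merge (u := v) (a := c) (b := d) (m := m) (q := e ++ ⟨u, a * b⟩ :: t)
          (isRotated_of_eq_append (⟨u, a * b⟩ :: t) (⟨v, c⟩ :: (m ++ ⟨v, d⟩ :: e))
          (by simp) (by simp)) hm,
          .merge (u := u) (a := a) (b := b) (m := []) (q := t ++ ⟨v, c * d⟩ :: (m ++ e))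
          (isRotated_of_eq_append (⟨v, c * d⟩ :: (m ++ e)) (⟨u, a⟩ :: ⟨u, b⟩ :: t)
          (by simp) (by simp)) (by simp), ?_⟩
        exact .of_isRotated (isRotated_of_eq_append (⟨v, c * d⟩ :: (m ++ e))
          (⟨u, a * b⟩ :: t) (by simp) (by simp))
  | @del v _ hr =>
    rcases cons_cons_isRotated_cons_cases hr with ⟨h₁, rfl⟩ | ⟨h₁, rfl⟩ | ⟨s, t, rfl, rfl⟩
    · cases h₁
      rw [one_mul]
      exact .inl (by rfl)
    · cases h₁
      rw [mul_one]
      exact .inl (CycEqv.append_comm [⟨u, a⟩] l)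
    · right
      refine ⟨_, _, .del (u := v) (isRotated_of_eq_append (⟨u, a * b⟩ :: t) (⟨v, 1⟩ :: s)
        (by simp) rfl), .merge (u := u) (a := a) (b := b) (m := []) (q := t ++ s)
        (isRotated_of_eq_append s (⟨u, a⟩ :: ⟨u, b⟩ :: t) (by simp) (by simp)) (by simp), ?_⟩
      exact .of_isRotated (isRotated_of_eq_append s (⟨u, a * b⟩ :: t) (by simp) (by simp))

theorem CycRed.cycJoin {l r s : List (Sigma G)} (hr : CycRed Γ l r) (hs : CycRed Γ l s) :
    CycJoin Γ r s := by
  -- Moving `⟨u, b⟩` back across `m` turns any merge into one of neighbouring syllables.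
  have key : ∀ {u : V} {a b : G u} {m q l r : List (Sigma G)},
      l ~r ⟨u, a⟩ :: (m ++ ⟨u, b⟩ :: q) → (∀ y ∈ m, Γ.Adj u y.1) → CycRed Γ l r →
      CycJoin Γ (⟨u, a * b⟩ :: (m ++ q)) r := by
    intro u a b m q l r h hm hr
    obtain ⟨r', hr', e⟩ := hr.exists_of_cycEqv ((CycEqv.of_isRotated h).trans
      (CycEqv.move [⟨u, a⟩] m q (x := ⟨u, b⟩) hm).symm)
    exact hr'.cycJoin_of_merge.trans_eqv e.symm
  cases hr with
  | merge h hm => exact key h hm hs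
  | @del u _ h =>
    cases hs with
    | merge h' hm => exact (key h' hm (.del h)).symm
    | @del v _ h' =>
      rcases cons_isRotated_cons_cases (h.symm.trans h') with ⟨-, rfl⟩ | ⟨p, t, rfl, rfl⟩
      · exact .inl (by rfl)
      · exact .inr ⟨_, _, .del (u := v) (isRotated_of_eq_append t (⟨v, 1⟩ :: p) rfl rfl),
          .del (u := u) (isRotated_of_eq_append p (⟨u, 1⟩ :: t) rfl rfl), .append_comm p t⟩

variable (Γ G) in
/-- The setoid of cyclic words up to length-preserving moves. -/
def cycSetoid : Setoid (List (Sigma G)) := EqvGen.setoid (CycStep Γ)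

variable (Γ G) in
/-- Reduction of cyclic words up to length-preserving moves. -/
def QRed (p q : Quotient (cycSetoid Γ G)) : Prop :=
  ∃ l r : List (Sigma G), p = ⟦l⟧ ∧ q = ⟦r⟧ ∧ CycRed Γ l r

/-- On classes, one side needs at most one step. This strong form of local confluence yields
Church–Rosser without an appeal to termination. -/
theorem QRed.diamond (p q q' : Quotient (cycSetoid Γ G)) (h : QRed Γ G p q) (h' : QRed Γ G p q') :
    ∃ d, ReflGen (QRed Γ G) q d ∧ ReflTransGen (QRed Γ G) q' d := by
  obtain ⟨l, r, rfl, rfl, hr⟩ := h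
  obtain ⟨l', s, hl, rfl, hs⟩ := h'
  obtain ⟨s', hs', e⟩ := hs.exists_of_cycEqv (CycEqv.symm (Quotient.exact hl))
  rcases (hr.cycJoin hs').trans_eqv e.symm with e | ⟨r', t', h₁, h₂, e⟩
  · exact ⟨⟦s⟧, by rw [show (⟦r⟧ : Quotient (cycSetoid Γ G)) = ⟦s⟧ from Quotient.sound e], .refl⟩
  · exact ⟨⟦r'⟧, .single ⟨r, r', rfl, rfl, h₁⟩, .single ⟨s, t', rfl, Quotient.sound e, h₂⟩⟩

variable (Γ) in
/-- Cyclic words with a common descendant. -/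
def CycConj (l l' : List (Sigma G)) : Prop :=
  Join (ReflTransGen (QRed Γ G)) ⟦l⟧ ⟦l'⟧

theorem cycConj_equivalence : Equivalence (CycConj Γ (G := G)) :=
  (equivalence_join_reflTransGen (QRed.diamond (Γ := Γ) (G := G))).comap
    (Quotient.mk (cycSetoid Γ G))

theorem CycEqv.cycConj {l l' : List (Sigma G)} (h : CycEqv Γ l l') : CycConj Γ l l' := by
  have : (⟦l⟧ : Quotient (cycSetoid Γ G)) = ⟦l'⟧ := Quotient.sound h
  rw [CycConj, this]
  exact ⟨_, .refl, .refl⟩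

theorem CycRed.cycConj {l l' : List (Sigma G)} (h : CycRed Γ l l') : CycConj Γ l l' :=
  ⟨⟦l'⟧, .single ⟨l, l', rfl, rfl, h⟩, .refl⟩

/-- Irreducible cyclic words with a common descendant differ by length-preserving moves. -/
theorem CycConj.cycEqv {l l' : List (Sigma G)} (h : CycConj Γ l l') (hl : ∀ r, ¬ CycRed Γ l r)
    (hl' : ∀ r, ¬ CycRed Γ l' r) : CycEqv Γ l l' := by
  have key : ∀ (l : List (Sigma G)) q, (∀ r, ¬ CycRed Γ l r) →
      ReflTransGen (QRed Γ G) ⟦l⟧ q → q = ⟦l⟧ := by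
    intro l q hl hq
    -- A first step starts at some representative of the class and transfers to `l` itself, which is
    -- irreducible.
    rcases hq.cases_head with h | ⟨_, ⟨l₁, r, h₁, -, hr⟩, -⟩
    · exact h.symm
    · obtain ⟨r', hr', -⟩ := hr.exists_of_cycEqv (CycEqv.symm (Quotient.exact h₁))
      exact absurd hr' (hl r')
  obtain ⟨q, h₁, h₂⟩ := h
  exact Quotient.exact ((key l q hl h₁).symm.trans (key l' q hl' h₂))

end Confluence

/-! ### From conjugacy in the graph product to cyclic rewriting -/

section WordValues

variable {V : Type*} (Γ : SimpleGraph V) {G : V → Type*} [∀ u, Group (G u)]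

theorem of_mul_of_comm {u v : V} (g : G u) (h : G v) (huv : Γ.Adj u v) :
    of Γ G u g * of Γ G v h = of Γ G v h * of Γ G u g := by
  have : (QuotientGroup.mk' (Subgroup.normalClosure (graphProductRelators Γ G)))
      (Monoid.CoprodI.of g * Monoid.CoprodI.of h * (Monoid.CoprodI.of g)⁻¹ *
      (Monoid.CoprodI.of h)⁻¹) = 1 :=
    (QuotientGroup.eq_one_iff _).2 (Subgroup.subset_normalClosure ⟨u, v, g, h, huv, rfl⟩)
  rw [map_mul, map_mul, map_mul, map_inv, map_inv, mul_inv_eq_one, mul_inv_eq_iff_eq_mul] at this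
  exact this

/-- The element of the graph product represented by a list of syllables. -/
def syllableProd (l : List (Sigma G)) : GraphProduct Γ G := (l.map fun x => of Γ G x.1 x.2).prod

variable {Γ}

@[simp] theorem syllableProd_nil : syllableProd Γ ([] : List (Sigma G)) = 1 := rfl

@[simp] theorem syllableProd_cons (x : Sigma G) (l : List (Sigma G)) :
    syllableProd Γ (x :: l) = of Γ G x.1 x.2 * syllableProd Γ l := by simp [syllableProd]

@[simp] theorem syllableProd_append (l l' : List (Sigma G)) :
    syllableProd Γ (l ++ l') = syllableProd Γ l * syllableProd Γ l' := by simp [syllableProd]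

/-- The relations between lists of syllables that define the graph product. -/
inductive SyllableRel (Γ : SimpleGraph V) : FreeMonoid (Sigma G) → FreeMonoid (Sigma G) → Prop
  | merge (u : V) (a b : G u) : SyllableRel Γ (.ofList [⟨u, a⟩, ⟨u, b⟩]) (.ofList [⟨u, a * b⟩])
  | del (u : V) : SyllableRel Γ (.ofList [⟨u, 1⟩]) 1
  | swap (x y : Sigma G) (h : Γ.Adj x.1 y.1) : SyllableRel Γ (.ofList [x, y]) (.ofList [y, x])

/-- The context `p`, `q` is arbitrary so that the product case can rewrite one factor while the
other joins the context. -/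
theorem cycConj_of_conGen {w w' : FreeMonoid (Sigma G)} (h : conGen (SyllableRel Γ) w w')
    (p q : List (Sigma G)) :
    CycConj Γ (p ++ w.toList ++ q) (p ++ w'.toList ++ q) := by
  have E := cycConj_equivalence (Γ := Γ) (G := G)
  change ConGen.Rel _ w w' at h
  induction h generalizing p q with
  | of w w' h =>
    cases h with
    | merge u a b =>
      refine E.trans (CycRed.cycConj (.merge (u := u) (a := a) (b := b) (m := []) (q := q ++ p)
        (isRotated_of_eq_append p (⟨u, a⟩ :: ⟨u, b⟩ :: q) (by simp) (by simp)) (by simp)))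
        (CycEqv.of_isRotated (isRotated_of_eq_append (⟨u, a * b⟩ :: q) p
        (by simp) (by simp))).cycConj
    | del u =>
      exact E.trans (CycRed.cycConj (.del (u := u) (l' := q ++ p)
        (isRotated_of_eq_append p (⟨u, 1⟩ :: q) (by simp) (by simp))))
        (CycEqv.of_isRotated (isRotated_of_eq_append q p (by simp) (by simp))).cycConj
    | swap x y h => simpa using (CycEqv.swap p q h).cycConj
  | refl => exact E.refl _
  | symm _ ih => exact E.symm (ih p q)
  | trans _ _ ih₁ ih₂ => exact E.trans (ih₁ p q) (ih₂ p q)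
  | @mul w x y z _ _ ih₁ ih₂ =>
    have h₁ := ih₁ p (y.toList ++ q)
    have h₂ := ih₂ (p ++ x.toList) q
    simp only [FreeMonoid.toList_mul, append_assoc] at h₁ h₂ ⊢
    exact E.trans h₁ h₂

theorem SyllableRel.coe_eq {w w' : FreeMonoid (Sigma G)} (h : SyllableRel Γ w w') :
    (w : (conGen (SyllableRel (G := G) Γ)).Quotient) = w' :=
  (Con.eq _).2 (ConGen.Rel.of _ _ h : conGen (SyllableRel Γ) w w')

variable (Γ) in
/-- The class of a syllable, as a homomorphism from its vertex group. -/
def syllableHom (u : V) : G u →* (conGen (SyllableRel (G := G) Γ)).Quotient where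
  toFun g := (FreeMonoid.ofList [⟨u, g⟩] : FreeMonoid (Sigma G))
  map_one' := (SyllableRel.del u).coe_eq
  map_mul' a b := (SyllableRel.merge u a b).coe_eq.symm

theorem lift_syllableHom_eq_one (x : Monoid.CoprodI G)
    (hx : x ∈ Subgroup.normalClosure (graphProductRelators Γ G)) :
    Monoid.CoprodI.lift (syllableHom (G := G) Γ) x = 1 := by
  suffices Subgroup.normalClosure (graphProductRelators Γ G) ≤
      (Monoid.CoprodI.lift (syllableHom (G := G) Γ)).ker from this hx
  refine Subgroup.normalClosure_le_normal ?_
  rintro _ ⟨u, v, g, h, huv, rfl⟩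
  have key : Monoid.CoprodI.lift (syllableHom (G := G) Γ)
      (Monoid.CoprodI.of g * Monoid.CoprodI.of h) =
      Monoid.CoprodI.lift (syllableHom (G := G) Γ)
        (Monoid.CoprodI.of h * Monoid.CoprodI.of g) := by
    rw [map_mul, map_mul, Monoid.CoprodI.lift_of, Monoid.CoprodI.lift_of]
    exact (SyllableRel.swap ⟨u, g⟩ ⟨v, h⟩ huv).coe_eq
  rw [SetLike.mem_coe, MonoidHom.mem_ker, mul_assoc, ← mul_inv_rev, map_mul, key, ← map_mul,
    mul_inv_cancel, map_one]

variable (Γ G) in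
/-- The map from the graph product to the monoid presented by syllables. -/
def toPresented : GraphProduct Γ G →* (conGen (SyllableRel (G := G) Γ)).Quotient :=
  QuotientGroup.lift (Subgroup.normalClosure (graphProductRelators Γ G))
    (Monoid.CoprodI.lift (syllableHom Γ)) lift_syllableHom_eq_one

theorem toPresented_of (u : V) (g : G u) : toPresented Γ G (of Γ G u g) = syllableHom Γ u g :=
  Monoid.CoprodI.lift_of (syllableHom Γ) g

theorem toPresented_syllableProd (l : List (Sigma G)) :
    toPresented Γ G (syllableProd Γ l) = (FreeMonoid.ofList l : FreeMonoid (Sigma G)) := by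
  induction l with
  | nil => exact map_one _
  | cons x l ih =>
    rw [syllableProd_cons, map_mul, ih, toPresented_of]
    rfl

theorem exists_syllableProd (g : GraphProduct Γ G) :
    ∃ l : List (Sigma G), syllableProd Γ l = g := by
  obtain ⟨x, rfl⟩ := QuotientGroup.mk'_surjective _ g
  induction x using Monoid.CoprodI.induction_on with
  | one => exact ⟨[], (map_one (QuotientGroup.mk' _)).symm⟩
  | of u g => exact ⟨[⟨u, g⟩], (syllableProd_cons _ _).trans (mul_one _)⟩
  | mul x y hx hy =>
    obtain ⟨l, hl⟩ := hx
    obtain ⟨l', hl'⟩ := hy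
    exact ⟨l ++ l', by rw [syllableProd_append, hl, hl']; exact (map_mul _ _ _).symm⟩

theorem cycConj_of_syllableProd_eq {l l' : List (Sigma G)}
    (h : syllableProd Γ l = syllableProd Γ l') (p q : List (Sigma G)) :
    CycConj Γ (p ++ l ++ q) (p ++ l' ++ q) := by
  have := congrArg (toPresented Γ G) h
  rw [toPresented_syllableProd, toPresented_syllableProd] at this
  exact cycConj_of_conGen ((Con.eq _).1 this) p q

/-- If `p` spells the conjugator and `p'` its inverse, then `p ++ l ++ p'` spells the same element
as `l'`. Rotation turns it into `p' ++ p ++ l`, where `p' ++ p` spells the identity. -/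
theorem cycConj_of_isConj {l l' : List (Sigma G)}
    (h : IsConj (syllableProd Γ l) (syllableProd Γ l')) : CycConj Γ l l' := by
  have E := cycConj_equivalence (Γ := Γ) (G := G)
  obtain ⟨g, hg⟩ := isConj_iff.1 h
  obtain ⟨p, rfl⟩ := exists_syllableProd g
  obtain ⟨p', hp⟩ := exists_syllableProd (syllableProd Γ p)⁻¹
  have h₁ := cycConj_of_syllableProd_eq (Γ := Γ) (l := p ++ l ++ p') (l' := l')
    (by simpa [hp, mul_assoc] using hg) [] []
  have h₂ := cycConj_of_syllableProd_eq (Γ := Γ) (l := p' ++ p) (l' := []) (by simp [hp]) [] l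
  simp only [nil_append, append_nil] at h₁ h₂
  refine E.trans (E.symm h₂) (E.trans (CycEqv.of_isRotated ?_).cycConj h₁)
  exact isRotated_of_eq_append p' (p ++ l) (by simp) rfl

end WordValues

end GraphProduct

/-! ### Computability tools -/

section Computability

/-- The fold is a recursion on the number of processed entries, each read off by its index. The
default for a missing entry never occurs within the length of the list. -/
theorem Computable.list_foldl {α β σ : Type*} [Primcodable α] [Primcodable β] [Primcodable σ]
    {f : α → List β} {g : α → σ} {h : α → σ × β → σ} (hf : Computable f) (hg : Computable g)
    (hh : Computable₂ h) : Computable fun a => (f a).foldl (fun s b => h a (s, b)) (g a) := by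
  have key : Computable fun a => Nat.rec (motive := fun _ => σ) (g a)
      (fun n s => ((f a)[n]?).elim s fun b => h a (s, b)) (f a).length := by
    refine Computable.nat_rec (h := fun a p => ((f a)[p.1]?).elim p.2 fun b => h a (p.2, b))
      (Computable.list_length.comp hf) hg ?_
    refine (Computable.option_casesOn (o := fun q : α × ℕ × σ => (f q.1)[q.2.1]?)
      (f := fun q => q.2.2) (g := fun q b => h q.1 (q.2.2, b))
      (Computable.list_getElem?.comp (hf.comp .fst) (Computable.fst.comp .snd))
      (Computable.snd.comp .snd)
      (hh.comp (Computable.fst.comp .fst)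
        ((Computable.snd.comp (Computable.snd.comp .fst)).pair .snd))).of_eq fun q => ?_
    dsimp only
    generalize (f q.1)[q.2.1]? = o
    cases o <;> rfl
  refine key.of_eq fun a => ?_
  have : ∀ n ≤ (f a).length, Nat.rec (motive := fun _ => σ) (g a)
      (fun n s => ((f a)[n]?).elim s fun b => h a (s, b)) n =
      ((f a).take n).foldl (fun s b => h a (s, b)) (g a) := by
    intro n hn
    induction n with
    | zero => simp
    | succ n ih =>
      rw [List.take_succ_eq_append_getElem hn, List.foldl_append]
      simp [ih (by omega), List.getElem?_eq_getElem (show n < (f a).length by omega)]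
  rw [this _ le_rfl, List.take_length]

theorem Computable.list_all {α β : Type*} [Primcodable α] [Primcodable β]
    {f : α → List β} {g : α → β → Bool} (hf : Computable f) (hg : Computable₂ g) :
    Computable fun a => (f a).all (g a) := by
  refine (Computable.list_foldl (g := fun _ => true) (h := fun a p => p.1 && g a p.2) hf (.const _)
    (Primrec.and.to_comp.comp (Computable.fst.comp .snd)
      (hg.comp .fst (Computable.snd.comp .snd)))).of_eq fun a => ?_
  have : ∀ (l : List β) (b : Bool), l.foldl (fun s c => s && g a c) b = (b && l.all (g a)) := by
    intro l
    induction l with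
    | nil => simp
    | cons c l ih => intro b; simp [ih, Bool.and_assoc]
  simp [this]

theorem Primrec.list_zip {α β : Type*} [Primcodable α] [Primcodable β] :
    Primrec₂ (List.zip : List α → List β → List (α × β)) := by
  -- The zip is a fold over the first list whose state holds the unused part of the second list and
  -- the pairs formed so far.
  have key : ∀ (c : List α) (d : List β) (acc : List (α × β)),
      c.foldl (fun s p => (s.1.tail, s.2 ++ s.1.head?.toList.map fun q => (p, q))) (d, acc) =
        (d.drop c.length, acc ++ c.zip d) := by
    intro c
    induction c with
    | nil => simp
    | cons p c ih => rintro (_ | ⟨q, d⟩) acc <;> simp [ih]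
  refine (Primrec.snd.comp (Primrec.list_foldl (f := fun p : List α × List β => p.1)
    (g := fun p => (p.2, ([] : List (α × β))))
    (h := fun _ r => (r.1.1.tail, r.1.2 ++ r.1.1.head?.toList.map fun q => (r.2, q)))
    Primrec.fst (Primrec.snd.pair (Primrec.const _)) ?_)).of_eq fun p => ?_
  · have h₁ : Primrec fun r : (List α × List β) × (List β × List (α × β)) × α => r.2.1.1 :=
      Primrec.fst.comp (Primrec.fst.comp Primrec.snd)
    refine (Primrec.list_tail.comp h₁).pair
      (Primrec.list_append.comp (Primrec.snd.comp (Primrec.fst.comp Primrec.snd)) ?_)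
    exact Primrec.list_map (Primrec.optionToList.comp (Primrec.list_head?.comp h₁))
      (Primrec.pair (Primrec.snd.comp (Primrec.snd.comp Primrec.fst)) Primrec.snd)
  · simp [key]

theorem Primrec.list_mem {α : Type*} [Primcodable α] [DecidableEq α] :
    Primrec₂ fun (l : List α) (a : α) => decide (a ∈ l) := by
  refine ((Primrec.eq (α := α)).exists_mem_list.decide).of_eq fun p => ?_
  simp

/-- A function on a product with a finite type is computable if all its sections are. -/
theorem Computable.of_finite_left {A β : Type*} [Finite A] [Primcodable A] [Primcodable β]
    {g : A → β → Bool} (hg : ∀ a, Computable (g a)) : Computable₂ g := by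
  classical
  -- The sections are glued one at a time by case distinction; no uniformity among their algorithms
  -- is required.
  have key : ∀ L : List A, ∃ h : A × β → Bool, Computable h ∧ ∀ a ∈ L, ∀ b, h (a, b) = g a b := by
    intro L
    induction L with
    | nil => exact ⟨fun _ => true, .const _, by simp⟩
    | cons a L ih =>
      obtain ⟨h, hh, hL⟩ := ih
      refine ⟨fun p => bif decide (p.1 = a) then g a p.2 else h p, Computable.cond
        (Primrec.eq.decide.to_comp.comp .fst (.const a)) ((hg a).comp .snd) hh, ?_⟩
      intro c hc b
      by_cases hca : c = a
      · subst hca; simp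
      · simpa [hca] using hL c (by simpa [hca] using hc) b
  obtain ⟨L, hL⟩ := Finite.exists_univ_list A
  obtain ⟨h, hh, hg'⟩ := key L
  exact hh.of_eq fun p => hg' p.1 (hL.2 p.1) p.2

/-- A predicate is decidable if every instance has a decidable certificate from which the answer can
be read off. -/
theorem ComputablePred.of_certificate {α σ : Type*} [Primcodable α] [Primcodable σ] {p : α → Prop}
    {v r : α → σ → Bool} (hv : Computable₂ v) (hr : Computable₂ r) (hex : ∀ a, ∃ s, v a s = true)
    (hspec : ∀ a s, v a s = true → (r a s = true ↔ p a)) : ComputablePred p := by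
  classical
  refine ⟨inferInstance, ?_⟩
  -- Unbounded search over codes: `n` is decoded to a candidate, and an answer is returned only if
  -- the candidate is a valid certificate.
  let f : α → ℕ → Option Bool := fun a n =>
    (Encodable.decode (α := σ) n).bind fun s => bif v a s then some (r a s) else none
  have hf : Computable₂ f := by
    refine Computable.option_bind (Computable.decode.comp .snd) ?_
    exact Computable.cond (hv.comp (Computable.fst.comp .fst) .snd)
      (Computable.option_some.comp (hr.comp (Computable.fst.comp .fst) .snd)) (.const _)
  have hmem : ∀ a n b, b ∈ f a n → b = decide (p a) := by
    intro a n b hb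
    obtain ⟨s, -, hs⟩ := Option.bind_eq_some_iff.1 hb
    cases hva : v a s
    · simp [hva] at hs
    · have := hspec a s hva
      simp only [hva, cond_true, Option.some.injEq] at hs
      rw [Bool.eq_iff_iff, decide_eq_true_iff, ← this, hs]
  refine (Partrec.rfindOpt hf).of_eq_tot fun a => ?_
  have hdom : (Nat.rfindOpt (f a)).Dom := by
    obtain ⟨s, hs⟩ := hex a
    exact Nat.rfindOpt_dom.2 ⟨Encodable.encode s, r a s, by simp [f, hs]⟩
  obtain ⟨b, hb⟩ := Part.dom_iff_mem.1 hdom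
  obtain ⟨n, hn⟩ := Nat.rfindOpt_spec hb
  rw [← hmem a n b hn]
  exact hb

end Computability

/-! ### The algorithm on coded words -/

namespace GraphProduct.Coded

section Algorithm

/-- Coded syllables: a code for a vertex and a word in the letters of its vertex group. -/
abbrev Syllable (A ι : Type*) := A × List (ι × Bool)

variable {A ι : Type*}

/-- Rotate a list by one, or transpose its first two syllables if they commute. -/
def move (adj : A → A → Bool) : Bool → List (Syllable A ι) → List (Syllable A ι)
  | true, l => l.drop 1 ++ l.take 1
  | false, p :: q :: l => bif adj p.1 q.1 then q :: p :: l else p :: q :: l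
  | false, l => l

/-- Merge the first two syllables if they have the same vertex, or delete the first one if it is
trivial. -/
def reduce [DecidableEq A] (conj : A → List (ι × Bool) → List (ι × Bool) → Bool) :
    Bool → List (Syllable A ι) → List (Syllable A ι)
  | true, p :: q :: l => bif p.1 = q.1 then (p.1, p.2 ++ q.2) :: l else p :: q :: l
  | true, l => l
  | false, p :: l => bif conj p.1 p.2 [] then l else p :: l
  | false, [] => []

/-- One instruction of the algorithm. -/
def act [DecidableEq A] (adj : A → A → Bool)
    (conj : A → List (ι × Bool) → List (ι × Bool) → Bool) (i : Bool × Bool)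
    (l : List (Syllable A ι)) : List (Syllable A ι) :=
  bif i.1 then move adj i.2 l else reduce conj i.2 l

/-- Execution of a list of instructions. -/
def run [DecidableEq A] (adj : A → A → Bool)
    (conj : A → List (ι × Bool) → List (ι × Bool) → Bool) (is : List (Bool × Bool))
    (l : List (Syllable A ι)) : List (Syllable A ι) :=
  is.foldl (fun l i => act adj conj i l) l

/-- At most one syllable of `l` does not commute with the vertex `a`. -/
def floating (adj : A → A → Bool) (l : List (Syllable A ι)) (a : A) : Bool :=
  (l.filter fun p => adj a p.1 = false).length ≤ 1

/-- The inverse of a word. -/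
def invWord (w : List (ι × Bool)) : List (ι × Bool) := (w.map fun p => (p.1, !p.2)).reverse

/-- Comparison of a syllable of `l` with another one: floating syllables are compared up to
conjugacy, the other ones up to equality. -/
def syllableMatch [DecidableEq A] (adj : A → A → Bool)
    (conj : A → List (ι × Bool) → List (ι × Bool) → Bool) (l : List (Syllable A ι))
    (r : Syllable A ι × Syllable A ι) : Bool :=
  decide (r.1.1 = r.2.1) && bif floating adj l r.1.1 then conj r.1.1 r.1.2 r.2.2
    else conj r.1.1 (r.1.2 ++ invWord r.2.2) []

/-- Comparison of two lists of syllables. -/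
def listMatch [DecidableEq A] (adj : A → A → Bool)
    (conj : A → List (ι × Bool) → List (ι × Bool) → Bool) (l l' : List (Syllable A ι)) : Bool :=
  decide (l.length = l'.length) && (l.zip l').all (syllableMatch adj conj l)

/-- The list `C` is closed under moves, and no member can be reduced. -/
def closed [DecidableEq A] [DecidableEq ι] (adj : A → A → Bool)
    (conj : A → List (ι × Bool) → List (ι × Bool) → Bool) (C : List (List (Syllable A ι))) : Bool :=
  C.all fun l => ((decide (move adj true l ∈ C) && decide (move adj false l ∈ C)) &&
    (decide (reduce conj true l = l) && decide (reduce conj false l = l)))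

/-- The certificates that the algorithm searches for: two programs and two lists. -/
abbrev Certificate (A ι : Type*) := (List (Bool × Bool) × List (Bool × Bool)) ×
  (List (List (Syllable A ι)) × List (List (Syllable A ι)))

/-- The comparison of the outcomes of the two programs of a certificate. -/
def answer [DecidableEq A] (adj : A → A → Bool)
    (conj : A → List (ι × Bool) → List (ι × Bool) → Bool)
    (w : List (Syllable A ι) × List (Syllable A ι)) (s : Certificate A ι) : Bool :=
  listMatch adj conj (run adj conj s.1.1 w.1) (run adj conj s.1.2 w.2)

/-- The test whether a certificate proves that two lists are not conjugate. -/
def refutes [DecidableEq A] [DecidableEq ι] (adj : A → A → Bool)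
    (conj : A → List (ι × Bool) → List (ι × Bool) → Bool)
    (w : List (Syllable A ι) × List (Syllable A ι)) (s : Certificate A ι) : Bool :=
  ((decide (run adj conj s.1.1 w.1 ∈ s.2.1) && decide (run adj conj s.1.2 w.2 ∈ s.2.2)) &&
    (closed adj conj s.2.1 && closed adj conj s.2.2)) &&
    s.2.1.all fun c => !listMatch adj conj c (run adj conj s.1.2 w.2)

end Algorithm

/-! ### Computability of the algorithm -/

section AlgorithmComputable

variable {A ι : Type*} [Primcodable A] [Primcodable ι] (adj : A → A → Bool)
  {conj : A → List (ι × Bool) → List (ι × Bool) → Bool}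

theorem primrec_move [Finite A] : Primrec₂ (move (ι := ι) adj) := by
  have hadj : Primrec₂ adj := Primrec.dom_finite _
  have h₁ : Primrec fun l : List (Syllable A ι) => move adj true l :=
    Primrec.list_append.comp (Primrec.list_drop.comp (Primrec.const 1) Primrec.id)
      (Primrec.list_take.comp (Primrec.const 1) Primrec.id)
  have h₂ : Primrec fun l : List (Syllable A ι) => move adj false l := by
    refine (Primrec.list_casesOn (f := fun l : List (Syllable A ι) => l) (g := fun _ => [])
      (h := fun l r => List.casesOn r.2 l fun q t => bif adj r.1.1 q.1 then q :: r.1 :: t else l)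
      Primrec.id (Primrec.const []) ?_).of_eq fun l => ?_
    · refine Primrec.list_casesOn
        (f := fun z : List (Syllable A ι) × Syllable A ι × List (Syllable A ι) => z.2.2)
        (g := fun z => z.1)
        (h := fun z r => bif adj z.2.1.1 r.1.1 then r.1 :: z.2.1 :: r.2 else z.1)
        (Primrec.snd.comp Primrec.snd) Primrec.fst ?_
      have hp : Primrec fun z : (List (Syllable A ι) × Syllable A ι × List (Syllable A ι)) ×
          Syllable A ι × List (Syllable A ι) => z.1.2.1 :=
        Primrec.fst.comp (Primrec.snd.comp Primrec.fst)
      have hq : Primrec fun z : (List (Syllable A ι) × Syllable A ι × List (Syllable A ι)) ×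
          Syllable A ι × List (Syllable A ι) => z.2.1 := Primrec.fst.comp Primrec.snd
      exact Primrec.cond (hadj.comp (Primrec.fst.comp hp) (Primrec.fst.comp hq))
        (Primrec.list_cons.comp hq (Primrec.list_cons.comp hp (Primrec.snd.comp Primrec.snd)))
        (Primrec.fst.comp Primrec.fst)
    · rcases l with _ | ⟨p, _ | ⟨q, l⟩⟩ <;> rfl
  refine (Primrec.cond Primrec.fst (h₁.comp Primrec.snd) (h₂.comp Primrec.snd)).of_eq ?_
  rintro ⟨_ | _, l⟩ <;> rfl

theorem primrec_floating [Finite A] : Primrec₂ (floating (ι := ι) adj) := by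
  have hrel : PrimrecRel fun (p : Syllable A ι) (a : A) => adj a p.1 = false := by
    refine PrimrecPred.of_eq (p := fun z : Syllable A ι × A => adj z.2 z.1.1 = false) ?_ fun _ => .rfl
    exact Primrec.eq.comp ((Primrec.dom_finite fun z : A × A => adj z.1 z.2).comp
      (Primrec.snd.pair (Primrec.fst.comp Primrec.fst))) (Primrec.const false)
  exact (Primrec.nat_le.comp (Primrec.list_length.comp hrel.listFilter) (Primrec.const 1)).decide

theorem primrec_invWord : Primrec (invWord : List (ι × Bool) → _) :=
  Primrec.list_reverse.comp (Primrec.list_map Primrec.id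
    ((Primrec.fst.comp Primrec.snd).pair (Primrec.not.comp (Primrec.snd.comp Primrec.snd))))

variable [DecidableEq A]

theorem primrec_reduce_true : Primrec (reduce conj true) := by
  refine (Primrec.list_casesOn (f := fun l : List (Syllable A ι) => l) (g := fun _ => [])
    (h := fun l r => List.casesOn r.2 l fun q t =>
      bif decide (r.1.1 = q.1) then (r.1.1, r.1.2 ++ q.2) :: t else l)
    Primrec.id (Primrec.const []) ?_).of_eq fun l => ?_
  · refine Primrec.list_casesOn
      (f := fun z : List (Syllable A ι) × Syllable A ι × List (Syllable A ι) => z.2.2)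
      (g := fun z => z.1)
      (h := fun z r =>
        bif decide (z.2.1.1 = r.1.1) then (z.2.1.1, z.2.1.2 ++ r.1.2) :: r.2 else z.1)
      (Primrec.snd.comp Primrec.snd) Primrec.fst ?_
    have hp : Primrec fun z : (List (Syllable A ι) × Syllable A ι × List (Syllable A ι)) ×
        Syllable A ι × List (Syllable A ι) => z.1.2.1 :=
      Primrec.fst.comp (Primrec.snd.comp Primrec.fst)
    have hq : Primrec fun z : (List (Syllable A ι) × Syllable A ι × List (Syllable A ι)) ×
        Syllable A ι × List (Syllable A ι) => z.2.1 := Primrec.fst.comp Primrec.snd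
    exact Primrec.cond (Primrec.eq.decide.comp (Primrec.fst.comp hp) (Primrec.fst.comp hq))
      (Primrec.list_cons.comp ((Primrec.fst.comp hp).pair
        (Primrec.list_append.comp (Primrec.snd.comp hp) (Primrec.snd.comp hq)))
        (Primrec.snd.comp Primrec.snd))
      (Primrec.fst.comp Primrec.fst)
  · rcases l with _ | ⟨p, _ | ⟨q, l⟩⟩ <;> rfl

theorem computable_reduce (hconj : Computable fun z : A × List (ι × Bool) × List (ι × Bool) =>
    conj z.1 z.2.1 z.2.2) : Computable₂ (reduce conj) := by
  have h₂ : Computable fun l : List (Syllable A ι) => reduce conj false l := by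
    refine (Computable.option_casesOn (o := fun l : List (Syllable A ι) => l.head?)
      (f := fun l => l) (g := fun l p => bif conj p.1 p.2 [] then l.tail else l)
      Primrec.list_head?.to_comp .id ?_).of_eq fun l => ?_
    · exact Computable.cond (hconj.comp ((Computable.fst.comp .snd).pair
        ((Computable.snd.comp .snd).pair (.const [])))) (Primrec.list_tail.to_comp.comp .fst) .fst
    · rcases l with _ | ⟨p, l⟩ <;> rfl
  refine (Computable.cond .fst ((primrec_reduce_true (conj := conj)).to_comp.comp .snd) (h₂.comp .snd)).of_eq ?_
  rintro ⟨_ | _, l⟩ <;> rfl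

variable [Finite A]

theorem computable_run (hconj : Computable fun z : A × List (ι × Bool) × List (ι × Bool) =>
    conj z.1 z.2.1 z.2.2) : Computable₂ (run adj conj) := by
  have hact : Computable₂ (act adj conj) :=
    Computable.cond (Computable.fst.comp .fst)
      ((primrec_move adj).to_comp.comp (Computable.snd.comp .fst) .snd)
      ((computable_reduce hconj).comp (Computable.snd.comp .fst) .snd)
  exact Computable.list_foldl (h := fun _ p => act adj conj p.2 p.1) .fst .snd
    (hact.comp (Computable.snd.comp .snd) (Computable.fst.comp .snd))

theorem computable_syllableMatch
    (hconj : Computable fun z : A × List (ι × Bool) × List (ι × Bool) => conj z.1 z.2.1 z.2.2) :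
    Computable₂ (syllableMatch adj conj) := by
  let T := List (Syllable A ι) × Syllable A ι × Syllable A ι
  have h₁ : Computable fun z : T => z.2.1 := Computable.fst.comp .snd
  have h₂ : Computable fun z : T => z.2.2 := Computable.snd.comp .snd
  have heq : Computable fun z : T => decide (z.2.1.1 = z.2.2.1) :=
    Computable₂.comp (f := fun a b : A => decide (a = b)) (g := fun z : T => z.2.1.1)
      (h := fun z : T => z.2.2.1) Primrec.eq.decide.to_comp
      (Computable.fst.comp h₁) (Computable.fst.comp h₂)
  have hfl : Computable fun z : T => floating adj z.1 z.2.1.1 :=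
    Computable₂.comp (f := floating (ι := ι) adj) (g := fun z : T => z.1)
      (h := fun z : T => z.2.1.1) (primrec_floating adj).to_comp .fst (Computable.fst.comp h₁)
  have hinv : Computable fun z : T => z.2.1.2 ++ invWord z.2.2.2 :=
    Computable₂.comp (f := fun l l' : List (ι × Bool) => l ++ l') (g := fun z : T => z.2.1.2)
      (h := fun z : T => invWord z.2.2.2) Computable.list_append (Computable.snd.comp h₁)
      (Computable.comp (f := invWord) (g := fun z : T => z.2.2.2) primrec_invWord.to_comp
        (Computable.snd.comp h₂))
  have hc : ∀ {f g : T → List (ι × Bool)}, Computable f → Computable g →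
      Computable fun z : T => conj z.2.1.1 (f z) (g z) := fun {f g} hf hg =>
    Computable.comp (f := fun z : A × List (ι × Bool) × List (ι × Bool) => conj z.1 z.2.1 z.2.2)
      (g := fun z : T => (z.2.1.1, f z, g z)) hconj ((Computable.fst.comp h₁).pair (hf.pair hg))
  have hand : ∀ {f g : T → Bool}, Computable f → Computable g →
      Computable fun z => f z && g z := fun hf hg => Primrec.and.to_comp.comp hf hg
  exact hand heq (Computable.cond hfl (hc (Computable.snd.comp h₁) (Computable.snd.comp h₂))
    (hc hinv (.const [])))

theorem computable_listMatch (hconj : Computable fun z : A × List (ι × Bool) × List (ι × Bool) =>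
    conj z.1 z.2.1 z.2.2) : Computable₂ (listMatch adj conj) := by
  let T := List (Syllable A ι) × List (Syllable A ι)
  have heq : Computable fun z : T => decide (z.1.length = z.2.length) :=
    Computable₂.comp (f := fun a b : ℕ => decide (a = b)) (g := fun z : T => z.1.length)
      (h := fun z : T => z.2.length) Primrec.eq.decide.to_comp
      (Computable.list_length.comp .fst) (Computable.list_length.comp .snd)
  have hall : Computable fun z : T => (z.1.zip z.2).all (syllableMatch adj conj z.1) :=
    Computable.list_all (f := fun z : T => z.1.zip z.2)
      (g := fun z => syllableMatch adj conj z.1) Primrec.list_zip.to_comp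
      (Computable₂.comp (f := syllableMatch adj conj)
        (g := fun z : T × Syllable A ι × Syllable A ι => z.1.1) (h := fun z => z.2)
        (computable_syllableMatch adj hconj) (Computable.fst.comp .fst) .snd)
  exact Primrec.and.to_comp.comp heq hall

variable (A ι) in
/-- The input of the algorithm together with a certificate. -/
abbrev Instance := (List (Syllable A ι) × List (Syllable A ι)) × Certificate A ι

theorem computable_run_left (hconj : Computable fun z : A × List (ι × Bool) × List (ι × Bool) =>
    conj z.1 z.2.1 z.2.2) : Computable fun z : Instance A ι => run adj conj z.2.1.1 z.1.1 :=
  Computable₂.comp (f := run adj conj) (g := fun z : Instance A ι => z.2.1.1)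
    (h := fun z : Instance A ι => z.1.1) (computable_run adj hconj)
    (Computable.fst.comp (Computable.fst.comp .snd)) (Computable.fst.comp .fst)

theorem computable_run_right (hconj : Computable fun z : A × List (ι × Bool) × List (ι × Bool) =>
    conj z.1 z.2.1 z.2.2) : Computable fun z : Instance A ι => run adj conj z.2.1.2 z.1.2 :=
  Computable₂.comp (f := run adj conj) (g := fun z : Instance A ι => z.2.1.2)
    (h := fun z : Instance A ι => z.1.2) (computable_run adj hconj)
    (Computable.snd.comp (Computable.fst.comp .snd)) (Computable.snd.comp .fst)

theorem computable_answer (hconj : Computable fun z : A × List (ι × Bool) × List (ι × Bool) =>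
    conj z.1 z.2.1 z.2.2) : Computable₂ (answer adj conj) :=
  Computable₂.comp (f := listMatch adj conj) (g := fun z : Instance A ι => run adj conj z.2.1.1 z.1.1)
    (h := fun z : Instance A ι => run adj conj z.2.1.2 z.1.2) (computable_listMatch adj hconj)
    (computable_run_left adj hconj) (computable_run_right adj hconj)

variable [DecidableEq ι]

theorem computable_closed (hconj : Computable fun z : A × List (ι × Bool) × List (ι × Bool) =>
    conj z.1 z.2.1 z.2.2) : Computable (closed adj conj) := by
  let T := List (Syllable A ι)
  have hmem : ∀ {f : List T × T → T}, Computable f →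
      Computable fun z : List T × T => decide (f z ∈ z.1) := fun {f} hf =>
    (Computable₂.comp (g := fun z : List T × T => z.1) (h := f)
      (Primrec.list_mem (α := T)).to_comp .fst hf).of_eq fun _ => decide_eq_decide.2 .rfl
  have heq : ∀ {f : List T × T → T}, Computable f →
      Computable fun z : List T × T => decide (f z = z.2) := fun {f} hf =>
    Computable₂.comp (f := fun a b : T => decide (a = b)) (g := f)
      (h := fun z : List T × T => z.2) (Primrec.eq (α := T)).decide.to_comp hf .snd
  have hmove : ∀ b, Computable fun z : List T × T => move adj b z.2 := fun b =>
    Computable₂.comp (f := move (ι := ι) adj) (g := fun _ : List T × T => b)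
      (h := fun z : List T × T => z.2) (primrec_move adj).to_comp (.const b) .snd
  have hred : ∀ b, Computable fun z : List T × T => reduce conj b z.2 := fun b =>
    Computable₂.comp (f := reduce conj) (g := fun _ : List T × T => b)
      (h := fun z : List T × T => z.2) (computable_reduce hconj) (.const b) .snd
  have hand : ∀ {f g : List T × T → Bool}, Computable f → Computable g →
      Computable fun z => f z && g z := fun hf hg => Primrec.and.to_comp.comp hf hg
  exact Computable.list_all (f := fun C : List T => C) .id
    (hand (hand (hmem (hmove true)) (hmem (hmove false)))
      (hand (heq (hred true)) (heq (hred false))))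

theorem computable_refutes (hconj : Computable fun z : A × List (ι × Bool) × List (ι × Bool) =>
    conj z.1 z.2.1 z.2.2) : Computable₂ (refutes adj conj) := by
  let T := List (Syllable A ι)
  have hmem : ∀ {f : Instance A ι → T} {g : Instance A ι → List T}, Computable f → Computable g →
      Computable fun z => decide (f z ∈ g z) := fun {f g} hf hg =>
    (Computable₂.comp (g := g) (h := f) (Primrec.list_mem (α := T)).to_comp hg hf).of_eq
      fun _ => decide_eq_decide.2 .rfl
  have hclosed : ∀ {g : Instance A ι → List T}, Computable g →
      Computable fun z => closed adj conj (g z) := fun hg =>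
    Computable.comp (f := closed adj conj) (computable_closed adj hconj) hg
  have hr₁ := computable_run_left adj hconj
  have hr₂ := computable_run_right adj hconj
  have hC₁ : Computable fun z : Instance A ι => z.2.2.1 :=
    Computable.fst.comp (Computable.snd.comp .snd)
  have hC₂ : Computable fun z : Instance A ι => z.2.2.2 :=
    Computable.snd.comp (Computable.snd.comp .snd)
  have hall : Computable fun z : Instance A ι =>
      z.2.2.1.all fun c => !listMatch adj conj c (run adj conj z.2.1.2 z.1.2) := by
    refine Computable.list_all (f := fun z : Instance A ι => z.2.2.1)
      (g := fun z c => !listMatch adj conj c (run adj conj z.2.1.2 z.1.2)) hC₁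
      (Primrec.not.to_comp.comp ?_)
    exact Computable₂.comp (f := listMatch adj conj) (g := fun z : Instance A ι × T => z.2)
      (h := fun z : Instance A ι × T => run adj conj z.1.2.1.2 z.1.1.2)
      (computable_listMatch adj hconj) .snd (hr₂.comp .fst)
  have hand : ∀ {f g : Instance A ι → Bool}, Computable f → Computable g →
      Computable fun z => f z && g z := fun hf hg => Primrec.and.to_comp.comp hf hg
  exact hand (hand (hand (hmem hr₁ hC₁) (hmem hr₂ hC₂)) (hand (hclosed hC₁) (hclosed hC₂))) hall

end AlgorithmComputable

end GraphProduct.Coded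

/-! ### Soundness of moves and of syllable matching -/

namespace GraphProduct

open List

section Match

variable {V : Type*} {Γ : SimpleGraph V} {G : V → Type*} [∀ u, Group (G u)]

theorem commute_syllableProd {u : V} (s : G u) {l : List (Sigma G)}
    (h : ∀ y ∈ l, Γ.Adj u y.1) : Commute (of Γ G u s) (syllableProd Γ l) := by
  induction l with
  | nil => exact Commute.one_right _
  | cons y l ih =>
    rw [syllableProd_cons]
    exact Commute.mul_right (of_mul_of_comm Γ s y.2 (h y (by simp)))
      (ih fun z hz => h z (by simp [hz]))

theorem CycStep.isConj {l l' : List (Sigma G)} (h : CycStep Γ l l') :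
    IsConj (syllableProd Γ l) (syllableProd Γ l') := by
  cases h with
  | rot h =>
    obtain ⟨s, t, rfl, rfl⟩ := exists_append_of_isRotated h
    exact isConj_iff.2 ⟨(syllableProd Γ s)⁻¹, by simp⟩
  | swap x y l h =>
    simp only [syllableProd_cons, ← mul_assoc, of_mul_of_comm Γ x.2 y.2 h]
    exact IsConj.refl _
  | conj u s a l h =>
    refine isConj_iff.2 ⟨of Γ G u s, ?_⟩
    have := (commute_syllableProd s h).inv_left.eq
    simp only [syllableProd_cons, map_mul, map_inv, mul_assoc, this]

theorem CycEqv.isConj {l l' : List (Sigma G)} (h : CycEqv Γ l l') :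
    IsConj (syllableProd Γ l) (syllableProd Γ l') := by
  induction h with
  | rel _ _ h => exact h.isConj
  | refl => exact IsConj.refl _
  | symm _ _ _ ih => exact ih.symm
  | trans _ _ _ _ _ ih₁ ih₂ => exact ih₁.trans ih₂

variable (Γ) in
/-- Two syllables of a word with list of vertices `vs` are equal, or they are conjugate and commute
with all other syllables. -/
def SyllableMatch (vs : List V) (y z : Sigma G) : Prop :=
  y = z ∨ ∃ (u : V) (a b : G u), y = ⟨u, a⟩ ∧ z = ⟨u, b⟩ ∧ IsConj a b ∧
    ∃ t, vs ~ u :: t ∧ ∀ v ∈ t, Γ.Adj u v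

theorem SyllableMatch.fst_eq {vs : List V} {y z : Sigma G} (h : SyllableMatch Γ vs y z) :
    y.1 = z.1 := by
  rcases h with rfl | ⟨u, a, b, rfl, rfl, -⟩ <;> rfl

theorem SyllableMatch.of_perm {vs vs' : List V} {y z : Sigma G} (h : SyllableMatch Γ vs y z)
    (hv : vs ~ vs') : SyllableMatch Γ vs' y z := by
  rcases h with rfl | ⟨u, a, b, rfl, rfl, hc, t, ht, h⟩
  · exact .inl rfl
  · exact .inr ⟨u, a, b, rfl, rfl, hc, t, hv.symm.trans ht, h⟩

/-- Syllables are replaced one by one, `p` being the part already treated. A replacement does not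
change the vertices, so the condition for floating syllables persists; such a syllable is rotated to
the front and conjugated there. -/
theorem isConj_of_forall₂ {l l' : List (Sigma G)} (p : List (Sigma G))
    (h : Forall₂ (SyllableMatch Γ ((p ++ l).map Sigma.fst)) l l') :
    IsConj (syllableProd Γ (p ++ l)) (syllableProd Γ (p ++ l')) := by
  induction l generalizing p l' with
  | nil => cases h; exact IsConj.refl _
  | cons y l ih =>
    rcases h with _ | @⟨_, z, _, l', hyz, hl⟩
    have hvs : (p ++ y :: l).map Sigma.fst = (p ++ [z] ++ l).map Sigma.fst := by
      simp [hyz.fst_eq]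
    have h₁ : IsConj (syllableProd Γ (p ++ y :: l)) (syllableProd Γ (p ++ z :: l)) := by
      rcases hyz with rfl | ⟨u, a, b, rfl, rfl, hc, t, ht, h⟩
      · exact IsConj.refl _
      · obtain ⟨s, rfl⟩ := isConj_iff.1 hc
        have hperm : (l ++ p).map Sigma.fst ~ t := by
          have h₀ : (⟨u, a⟩ :: l ++ p).map Sigma.fst ~ u :: t :=
            (Perm.map Sigma.fst (perm_append_comm (l₁ := ⟨u, a⟩ :: l) (l₂ := p))).trans ht
          exact Perm.cons_inv (a := u) (by simpa using h₀)
        have hadj : ∀ y ∈ l ++ p, Γ.Adj u y.1 := fun y hy =>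
          h _ (hperm.subset (mem_map_of_mem hy))
        exact (CycEqv.append_comm p (⟨u, a⟩ :: l)).isConj.trans
          ((CycStep.conj u s a _ hadj).isConj.trans (CycEqv.append_comm (⟨u, _⟩ :: l) p).isConj)
    rw [hvs] at hl
    have := ih (p ++ [z]) hl
    simp only [append_assoc, singleton_append] at this
    exact h₁.trans this

end Match

/-! ### Correctness of the tests on coded words -/

namespace Coded

section Correctness

variable {V : Type*} {Γ : SimpleGraph V} {G : V → Type*} [∀ u, Group (G u)] {A ι : Type*}
  {f : A → V} (x : ∀ a, ι → G (f a))

/-- The list of syllables that is coded by a list. -/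
def syllables (l : List (Syllable A ι)) : List (Sigma G) :=
  l.map fun p => ⟨f p.1, wordValue (x p.1) p.2⟩

theorem wordValue_invWord {H : Type*} [Group H] (y : ι → H) (w : List (ι × Bool)) :
    wordValue y (invWord w) = (wordValue y w)⁻¹ := by
  induction w with
  | nil => simp [wordValue, invWord]
  | cons p w ih =>
    have h₁ : invWord (p :: w) = invWord w ++ [(p.1, !p.2)] := by simp [invWord]
    have h₂ : p :: w = [p] ++ w := rfl
    rw [h₁, h₂, wordValue_append, wordValue_append, ih, mul_inv_rev]
    congr 1
    rcases p with ⟨i, _ | _⟩ <;> simp [wordValue]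

variable {adj : A → A → Bool} {conj : A → List (ι × Bool) → List (ι × Bool) → Bool}

theorem cycEqv_move (hadj : ∀ a b, adj a b = true ↔ Γ.Adj (f a) (f b)) (b : Bool)
    (l : List (Syllable A ι)) : CycEqv Γ (syllables x (move adj b l)) (syllables x l) := by
  cases b
  · rcases l with _ | ⟨p, _ | ⟨q, l⟩⟩
    · rfl
    · rfl
    · simp only [move]
      cases h : adj p.1 q.1
      · rfl
      · exact (CycStep.swap _ _ _ ((hadj _ _).1 h).symm).eqv
  · refine .of_isRotated (isRotated_of_eq_append (syllables x (l.drop 1))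
      (syllables x (l.take 1)) ?_ ?_)
    · simp [move, syllables]
    · rw [syllables, syllables, syllables, ← map_append, take_append_drop]

theorem syllableProd_reduce [DecidableEq A]
    (hconj : ∀ a w w', conj a w w' = true ↔ IsConj (wordValue (x a) w) (wordValue (x a) w'))
    (b : Bool) (l : List (Syllable A ι)) :
    syllableProd Γ (syllables x (reduce conj b l)) = syllableProd Γ (syllables x l) := by
  cases b
  · rcases l with _ | ⟨p, l⟩
    · rfl
    · simp only [reduce]
      cases h : conj p.1 p.2 []
      · rfl
      · have : wordValue (x p.1) p.2 = 1 := isConj_one_right.1 ((hconj _ _ _).1 h).symm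
        simp [syllables, this]
  · rcases l with _ | ⟨⟨a, w⟩, _ | ⟨⟨a', w'⟩, l⟩⟩
    · rfl
    · rfl
    · by_cases h : a = a'
      · subst h
        simp [reduce, syllables, wordValue_append, mul_assoc]
      · simp [reduce, h]

theorem isConj_run [DecidableEq A] (hadj : ∀ a b, adj a b = true ↔ Γ.Adj (f a) (f b))
    (hconj : ∀ a w w', conj a w w' = true ↔ IsConj (wordValue (x a) w) (wordValue (x a) w'))
    (is : List (Bool × Bool)) (l : List (Syllable A ι)) :
    IsConj (syllableProd Γ (syllables x (run adj conj is l))) (syllableProd Γ (syllables x l)) := by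
  induction is generalizing l with
  | nil => exact IsConj.refl _
  | cons i is ih =>
    refine (ih (act adj conj i l)).trans ?_
    rcases i with ⟨_ | _, b⟩
    · simp only [act, cond_false, syllableProd_reduce x hconj]
      exact IsConj.refl _
    · exact (cycEqv_move x hadj b l).isConj

theorem floating_iff (hadj : ∀ a b, adj a b = true ↔ Γ.Adj (f a) (f b))
    {l : List (Syllable A ι)} {p : Syllable A ι} (hp : p ∈ l) :
    floating adj l p.1 = true ↔
      ∃ t, (syllables x l).map Sigma.fst ~ f p.1 :: t ∧ ∀ v ∈ t, Γ.Adj (f p.1) v := by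
  have hl : (syllables x l).map Sigma.fst = l.map fun q => f q.1 := by simp [syllables]
  rw [hl]
  -- The syllable `p` is itself among those counted, as adjacency is irreflexive; a count of at most
  -- one therefore leaves only `p`.
  have hpf : p ∈ l.filter fun q => adj p.1 q.1 = false := by
    simp only [mem_filter, hp, true_and, decide_eq_true_eq]
    rw [← Bool.not_eq_true, hadj]
    exact Γ.irrefl
  have hperm := (filter_append_perm (fun q : Syllable A ι => decide (adj p.1 q.1 = false)) l).symm
  constructor
  · intro h
    obtain ⟨q, hq⟩ := length_eq_one_iff.1 (le_antisymm (by simpa [floating] using h)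
      (length_pos_of_mem hpf))
    rw [hq, mem_singleton] at hpf
    rw [hq, ← hpf] at hperm
    refine ⟨_, by simpa using hperm.map fun q => f q.1, ?_⟩
    simp only [mem_map, mem_filter]
    rintro _ ⟨q, ⟨-, hq⟩, rfl⟩
    exact (hadj _ _).1 (by simpa using hq)
  · classical
    rintro ⟨t, ht, hadj'⟩
    -- Conversely, in `f p.1 :: t` only the head can fail to be adjacent to `f p.1`, which bounds
    -- the count by one.
    have h₁ := (ht.filter fun v => decide (¬ Γ.Adj (f p.1) v)).length_eq
    have h₂ : t.filter (fun v => decide (¬ Γ.Adj (f p.1) v)) = [] := by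
      simpa using hadj'
    have h₃ : (l.filter fun q => decide (adj p.1 q.1 = false)) =
        l.filter ((fun v => decide (¬ Γ.Adj (f p.1) v)) ∘ fun q => f q.1) := by
      refine filter_congr fun q _ => ?_
      simp [← hadj]
    rw [filter_cons, h₂, filter_map, length_map, ← h₃] at h₁
    simp only [floating, h₁]
    split <;> simp

theorem syllableMatch_iff [DecidableEq A] (hf : f.Injective)
    (hadj : ∀ a b, adj a b = true ↔ Γ.Adj (f a) (f b))
    (hconj : ∀ a w w', conj a w w' = true ↔ IsConj (wordValue (x a) w) (wordValue (x a) w'))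
    {l : List (Syllable A ι)} {p q : Syllable A ι} (hp : p ∈ l) :
    syllableMatch adj conj l (p, q) = true ↔ SyllableMatch Γ ((syllables x l).map Sigma.fst)
      ⟨f p.1, wordValue (x p.1) p.2⟩ ⟨f q.1, wordValue (x q.1) q.2⟩ := by
  obtain ⟨a, w⟩ := p
  obtain ⟨b, w'⟩ := q
  have hfl := floating_iff x hadj hp
  by_cases hab : a = b
  · subst hab
    simp only [syllableMatch, decide_true, Bool.true_and]
    cases h : floating adj l a
    · rw [cond_false, hconj, wordValue_append, wordValue_invWord]
      -- Only the identity is conjugate to the identity, so the conjugacy test also decides equality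
      -- in the vertex group.
      have h₁ : IsConj (wordValue (x a) w * (wordValue (x a) w')⁻¹) (wordValue (x a) []) ↔
          wordValue (x a) w = wordValue (x a) w' := by
        rw [isConj_comm]
        exact isConj_one_right.trans mul_inv_eq_one
      rw [h₁]
      constructor
      · intro h; exact .inl (by rw [h])
      · rintro (h | ⟨u, c, d, hc, -, -, ht⟩)
        · simpa using h
        · cases hc
          simp [h] at hfl
          obtain ⟨t, ht, h'⟩ := ht
          obtain ⟨v, hv, hv'⟩ := hfl t ht
          exact absurd (h' v hv) hv'
    · rw [cond_true, hconj]
      constructor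
      · exact fun hc => .inr ⟨_, _, _, rfl, rfl, hc, hfl.1 h⟩
      · rintro (h | ⟨u, c, d, hc, hd, hcd, -⟩)
        · simp only [Sigma.mk.injEq, heq_eq_eq, true_and] at h
          rw [h]
        · cases hc
          cases hd
          exact hcd
  · simp only [syllableMatch, hab, decide_false, Bool.false_and, Bool.false_eq_true, false_iff]
    exact fun h => hab (hf h.fst_eq)

theorem listMatch_iff [DecidableEq A] (hf : f.Injective)
    (hadj : ∀ a b, adj a b = true ↔ Γ.Adj (f a) (f b))
    (hconj : ∀ a w w', conj a w w' = true ↔ IsConj (wordValue (x a) w) (wordValue (x a) w'))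
    (l l' : List (Syllable A ι)) :
    listMatch adj conj l l' = true ↔ Forall₂ (SyllableMatch Γ ((syllables x l).map Sigma.fst))
      (syllables x l) (syllables x l') := by
  conv_rhs => rw [syllables, syllables, forall₂_map_left_iff, forall₂_map_right_iff,
    forall₂_iff_zip]
  simp only [listMatch, Bool.and_eq_true, decide_eq_true_eq, all_eq_true, Prod.forall]
  refine and_congr_right fun _ => ⟨fun h a w b w' hpq => ?_, fun h a w b w' hpq => ?_⟩
  · exact (syllableMatch_iff x hf hadj hconj (of_mem_zip hpq).1).1 (h _ _ _ _ hpq)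
  · exact (syllableMatch_iff x hf hadj hconj (of_mem_zip hpq).1).2 (h _ _ _ _ hpq)

section Closed

variable [DecidableEq A] [DecidableEq ι] {C : List (List (Syllable A ι))}

theorem closed_iff : closed adj conj C = true ↔ ∀ l ∈ C, (∀ b, move adj b l ∈ C) ∧
    ∀ b, reduce conj b l = l := by
  simp only [closed, all_eq_true, Bool.and_eq_true, decide_eq_true_eq, Bool.forall_bool]
  exact forall₂_congr fun _ _ => by tauto

theorem move_true_iterate_mem (h : closed adj conj C = true) {s t : List (Syllable A ι)}
    (hC : s ++ t ∈ C) : t ++ s ∈ C := by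
  induction s generalizing t with
  | nil => simpa using hC
  | cons p s ih =>
    have := ((closed_iff.1 h) _ hC).1 true
    simp only [move, cons_append, drop_succ_cons, drop_zero, take_succ_cons, take_zero,
      append_assoc] at this
    simpa using ih this

/-- Every list of syllables obtained by moves from a list coded in a closed list matches a list
coded there. -/
theorem exists_forall₂_of_cycEqv (hadj : ∀ a b, adj a b = true ↔ Γ.Adj (f a) (f b))
    (h : closed adj conj C = true) {l l' : List (Sigma G)} (hl : CycEqv Γ l l')
    (hC : ∃ c ∈ C, Forall₂ (SyllableMatch Γ ((syllables x c).map Sigma.fst)) (syllables x c) l) :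
    ∃ c ∈ C, Forall₂ (SyllableMatch Γ ((syllables x c).map Sigma.fst)) (syllables x c) l' := by
  have key : ∀ {l l' : List (Sigma G)}, CycStep Γ l l' →
      (∃ c ∈ C, Forall₂ (SyllableMatch Γ ((syllables x c).map Sigma.fst)) (syllables x c) l) →
      ∃ c ∈ C, Forall₂ (SyllableMatch Γ ((syllables x c).map Sigma.fst)) (syllables x c) l' := by
    rintro l l' hl ⟨c, hc, hm⟩
    cases hl with
    | rot hr =>
      obtain ⟨s, t, rfl, rfl⟩ := exists_append_of_isRotated hr
      have h₁ := forall₂_take_append _ _ _ hm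
      have h₂ := forall₂_drop_append _ _ _ hm
      refine ⟨c.drop s.length ++ c.take s.length, move_true_iterate_mem h
        (by simpa using hc), ?_⟩
      have hs : syllables x (c.drop s.length ++ c.take s.length) =
        (syllables x c).drop s.length ++ (syllables x c).take s.length := by simp [syllables]
      rw [hs]
      refine Forall₂.imp (fun _ _ hyz => hyz.of_perm ?_) (rel_append h₂ h₁)
      conv_lhs => rw [← take_append_drop s.length (syllables x c)]
      exact perm_append_comm.map _
    | swap y z l hyz =>
      rcases c with _ | ⟨p, _ | ⟨q, c⟩⟩
      · cases hm
      · rcases hm with _ | ⟨-, hm⟩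
        cases hm
      · rcases hm with _ | ⟨hy, _ | ⟨hz, hm⟩⟩
        have hpq : adj p.1 q.1 = true := by
          rw [hadj]
          have h₁ := hy.fst_eq
          have h₂ := hz.fst_eq
          simp only at h₁ h₂
          rwa [h₁, h₂]
        have hmove := ((closed_iff.1 h) _ hc).1 false
        simp only [move, hpq, cond_true] at hmove
        have hperm : (syllables x (p :: q :: c)).map Sigma.fst ~
          (syllables x (q :: p :: c)).map Sigma.fst := Perm.map _ (Perm.swap _ _ _)
        exact ⟨_, hmove, .cons (hz.of_perm hperm) (.cons (hy.of_perm hperm)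
          (hm.imp fun _ _ h => h.of_perm hperm))⟩
    | conj u s a l hu =>
      rcases c with _ | ⟨p, c⟩
      · cases hm
      · have hvs : ((syllables x (p :: c)).map Sigma.fst) = u :: l.map Sigma.fst := by
          rw [← forall₂_eq_eq_eq, forall₂_map_left_iff]
          have : Forall₂ (fun y v => y.1 = v) (syllables x (p :: c))
              (((⟨u, a⟩ : Sigma G) :: l).map Sigma.fst) := by
            rw [forall₂_map_right_iff]
            exact hm.imp fun _ _ h => h.fst_eq
          exact this
        -- The coded list stays the same: the conjugated syllable is floating, and matching allows
        -- floating syllables to differ by conjugacy.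
        refine ⟨_, hc, ?_⟩
        rcases hm with _ | ⟨hy, hm⟩
        refine .cons ?_ hm
        have hc' : IsConj a (s * a * s⁻¹) := isConj_iff.2 ⟨s, rfl⟩
        have ht : ∃ t, (syllables x (p :: c)).map Sigma.fst ~ u :: t ∧ ∀ v ∈ t, Γ.Adj u v :=
          ⟨_, by rw [hvs], by simpa using fun v y hy => hu ⟨v, y⟩ hy⟩
        rcases hy with hy | ⟨v, b, d, hb, hd, hbd, -⟩
        · exact .inr ⟨u, a, _, hy, rfl, hc', ht⟩
        · cases hd
          exact .inr ⟨u, b, _, hb, rfl, hbd.trans hc', ht⟩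
  suffices ∀ {l l' : List (Sigma G)}, CycEqv Γ l l' →
      ((∃ c ∈ C, Forall₂ (SyllableMatch Γ ((syllables x c).map Sigma.fst)) (syllables x c) l) ↔
      ∃ c ∈ C, Forall₂ (SyllableMatch Γ ((syllables x c).map Sigma.fst)) (syllables x c) l') from
    (this hl).1 hC
  intro l l' hl
  induction hl with
  | rel _ _ hs => exact ⟨key hs, key hs.symm⟩
  | refl => rfl
  | symm _ _ _ ih => exact ih.symm
  | trans _ _ _ _ _ ih₁ ih₂ => exact ih₁.trans ih₂

/-- The lists in a closed list code irreducible cyclic words. -/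
theorem not_cycRed_of_closed (hf : f.Injective)
    (hadj : ∀ a b, adj a b = true ↔ Γ.Adj (f a) (f b))
    (hconj : ∀ a w w', conj a w w' = true ↔ IsConj (wordValue (x a) w) (wordValue (x a) w'))
    (h : closed adj conj C = true) {c : List (Syllable A ι)} (hc : c ∈ C) (r : List (Sigma G)) :
    ¬ CycRed Γ (syllables x c) r := by
  have hrot : ∀ {l l' : List (Sigma G)}, l ~r l' → (∃ c ∈ C, syllables x c = l) →
      ∃ c ∈ C, syllables x c = l' := by
    rintro l l' hr ⟨c, hc, rfl⟩
    obtain ⟨s, t, hs, rfl⟩ := exists_append_of_isRotated hr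
    obtain ⟨c₁, c₂, rfl, rfl, rfl⟩ := map_eq_append_iff.1 hs
    exact ⟨c₂ ++ c₁, move_true_iterate_mem h hc, by simp [syllables]⟩
  have hswap : ∀ {p q : List (Sigma G)} {y z : Sigma G}, Γ.Adj y.1 z.1 →
      (∃ c ∈ C, syllables x c = p ++ y :: z :: q) → ∃ c ∈ C, syllables x c = p ++ z :: y :: q := by
    intro p q y z hyz hC
    -- Coded swaps act only on the first two syllables, so the pair is rotated to the front and back
    -- again.
    obtain ⟨c, hc, hs⟩ := hrot (isRotated_append (l := p) (l' := y :: z :: q)) hC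
    obtain ⟨a, c, rfl, rfl, hs'⟩ := map_eq_cons_iff.1 hs
    obtain ⟨b, c, rfl, rfl, hs''⟩ := map_eq_cons_iff.1 hs'
    refine hrot (isRotated_append (l := _ :: _ :: q)) ⟨b :: a :: c, ?_, ?_⟩
    · have := ((closed_iff.1 h) _ hc).1 false
      rwa [move, (hadj _ _).2 hyz, cond_true] at this
    · rw [syllables, map_cons, map_cons, hs'']
      rfl
  have hmove : ∀ {m p q : List (Sigma G)} {z : Sigma G}, (∀ y ∈ m, Γ.Adj z.1 y.1) →
      (∃ c ∈ C, syllables x c = p ++ (m ++ z :: q)) → ∃ c ∈ C, syllables x c = p ++ z :: (m ++ q) := by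
    intro m
    induction m with
    | nil => exact fun _ h => h
    | cons y m ih =>
      intro p q z hm hC
      have := ih (p := p ++ [y]) (fun w hw => hm w (by simp [hw])) (by simpa using hC)
      exact hswap (hm y (by simp)).symm (by simpa using this)
  intro hred
  cases hred with
  | @merge u a b m q hr hm =>
    obtain ⟨c, hc, hs⟩ := hmove (p := [⟨u, a⟩]) (z := ⟨u, b⟩) hm (hrot hr ⟨c, hc, rfl⟩)
    obtain ⟨p, c, rfl, hp, hs'⟩ := map_eq_cons_iff.1 hs
    obtain ⟨q, c, rfl, hq, -⟩ := map_eq_cons_iff.1 hs'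
    have := ((closed_iff.1 h) _ hc).2 true
    have hpq : p.1 = q.1 := hf ((congrArg Sigma.fst hp).trans (congrArg Sigma.fst hq).symm)
    simp only [reduce, hpq, decide_true, cond_true] at this
    -- The merge shortens the list, contradicting that members of `C` are fixed by `reduce`.
    simpa using congrArg length this
  | @del u _ hr =>
    obtain ⟨c, hc, hs⟩ := hrot hr ⟨c, hc, rfl⟩
    obtain ⟨p, c, rfl, hp, -⟩ := map_eq_cons_iff.1 hs
    have := ((closed_iff.1 h) _ hc).2 false
    have hp' : conj p.1 p.2 [] = true := by
      rw [hconj]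
      obtain ⟨rfl, hp⟩ := Sigma.mk.inj_iff.1 hp
      rw [eq_of_heq hp]
      exact IsConj.refl _
    simp only [reduce, hp', cond_true] at this
    simpa using congrArg length this

end Closed

end Correctness

end Coded

end GraphProduct

/-! ### Existence of certificates and the decision -/

namespace GraphProduct.Coded

open List

section Termination

variable {A ι : Type*} {adj : A → A → Bool}
  {conj : A → List (ι × Bool) → List (ι × Bool) → Bool}

theorem move_perm (b : Bool) (l : List (Syllable A ι)) : move adj b l ~ l := by
  cases b
  · rcases l with _ | ⟨p, _ | ⟨q, l⟩⟩
    · rfl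
    · rfl
    · simp only [move]
      cases adj p.1 q.1
      · rfl
      · exact Perm.swap _ _ _
  · exact perm_append_comm.trans (by rw [take_append_drop])

variable [DecidableEq A]

theorem reduce_eq_or_length_lt (b : Bool) (l : List (Syllable A ι)) :
    reduce conj b l = l ∨ (reduce conj b l).length < l.length := by
  cases b
  · rcases l with _ | ⟨p, l⟩
    · exact .inl rfl
    · simp only [reduce]
      cases conj p.1 p.2 [] <;> simp
  · rcases l with _ | ⟨p, _ | ⟨q, l⟩⟩
    · exact .inl rfl
    · exact .inl rfl
    · simp only [reduce]
      cases decide (p.1 = q.1) <;> simp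

theorem run_append (is js : List (Bool × Bool)) (l : List (Syllable A ι)) :
    run adj conj (is ++ js) l = run adj conj js (run adj conj is l) := foldl_append

variable [DecidableEq ι]

variable (adj conj) in
/-- Every list of syllables is brought into a closed list by a program. -/
theorem exists_closed (l : List (Syllable A ι)) : ∃ is C, closed adj conj C = true ∧
    run adj conj is l ∈ C ∧ ∀ c ∈ C, ∃ js, c = run adj conj js (run adj conj is l) := by
  induction hn : l.length using Nat.strong_induction_on generalizing l with
  | _ n ih =>
    -- The orbit of `l` under coded moves. It consists of permutations of `l`, hence is finite; if
    -- no member can be reduced it is the required closed list, and otherwise reducing a member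
    -- gives a shorter list for the induction.
    let S : Set (List (Syllable A ι)) :=
      {c | ∃ bs : List Bool, c = run adj conj (bs.map fun b => (true, b)) l}
    have hstep : ∀ c ∈ S, ∀ b, move adj b c ∈ S := by
      rintro c ⟨bs, rfl⟩ b
      exact ⟨bs ++ [b], by rw [map_append, run_append]; rfl⟩
    have hperm : ∀ c ∈ S, c ~ l := by
      rintro c ⟨bs, rfl⟩
      induction bs using List.reverseRecOn with
      | nil => rfl
      | append_singleton bs b ih =>
        rw [map_append, run_append]
        exact (move_perm b _).trans ih
    by_cases hS : ∀ c ∈ S, ∀ b, reduce conj b c = c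
    · have hfin : S.Finite := (l.permutations.toFinset.finite_toSet).subset fun c hc => by
        simpa using hperm c hc
      refine ⟨[], hfin.toFinset.toList, closed_iff.2 fun c hc => ?_, ?_, fun c hc => ?_⟩
      · have hc' : c ∈ S := by simpa using hc
        exact ⟨fun b => by simpa using hstep c hc' b, hS c hc'⟩
      · simpa using (show run adj conj [] l ∈ S from ⟨[], rfl⟩)
      · obtain ⟨bs, h⟩ : c ∈ S := by simpa using hc
        exact ⟨_, h⟩
    · push Not at hS
      obtain ⟨c, hc, b, hb⟩ := hS
      have hlt := (reduce_eq_or_length_lt b c).resolve_left hb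
      rw [(hperm c hc).length_eq, hn] at hlt
      obtain ⟨is, C, hC, hmem, hC'⟩ := ih _ hlt _ rfl
      obtain ⟨bs, rfl⟩ := hc
      have hrun : run adj conj ((bs.map fun b => (true, b)) ++ (false, b) :: is) l =
          run adj conj is (reduce conj b (run adj conj (bs.map fun b => (true, b)) l)) := by
        rw [run_append]
        rfl
      exact ⟨_, C, hC, by rwa [hrun], by rwa [hrun]⟩

end Termination

section Decision

variable {V : Type*} {Γ : SimpleGraph V} {G : V → Type*} [∀ u, Group (G u)] {A ι : Type*}
  {f : A → V} (x : ∀ a, ι → G (f a)) [DecidableEq A] {adj : A → A → Bool}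
  {conj : A → List (ι × Bool) → List (ι × Bool) → Bool}

theorem isConj_of_answer (hf : f.Injective) (hadj : ∀ a b, adj a b = true ↔ Γ.Adj (f a) (f b))
    (hconj : ∀ a w w', conj a w w' = true ↔ IsConj (wordValue (x a) w) (wordValue (x a) w'))
    {w : List (Syllable A ι) × List (Syllable A ι)} {s : Certificate A ι}
    (h : answer adj conj w s = true) :
    IsConj (syllableProd Γ (syllables x w.1)) (syllableProd Γ (syllables x w.2)) := by
  have := isConj_of_forall₂ [] ((listMatch_iff x hf hadj hconj _ _).1 h)
  exact (isConj_run x hadj hconj s.1.1 w.1).symm.trans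
    (this.trans (isConj_run x hadj hconj s.1.2 w.2))

variable [DecidableEq ι]

/-- If the inputs were conjugate, the outcomes of both programs would be conjugate and irreducible,
hence equivalent under moves. Following these moves inside the first closed list would produce a
member matching the second outcome. -/
theorem not_isConj_of_refutes (hf : f.Injective)
    (hadj : ∀ a b, adj a b = true ↔ Γ.Adj (f a) (f b))
    (hconj : ∀ a w w', conj a w w' = true ↔ IsConj (wordValue (x a) w) (wordValue (x a) w'))
    {w : List (Syllable A ι) × List (Syllable A ι)} {s : Certificate A ι}
    (h : refutes adj conj w s = true) :
    ¬ IsConj (syllableProd Γ (syllables x w.1)) (syllableProd Γ (syllables x w.2)) := by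
  simp only [refutes, Bool.and_eq_true, decide_eq_true_eq, all_eq_true, Bool.not_eq_true'] at h
  obtain ⟨⟨⟨hm₁, hm₂⟩, hc₁, hc₂⟩, hno⟩ := h
  intro hw
  have hrun := (isConj_run x hadj hconj s.1.1 w.1).trans
    (hw.trans (isConj_run x hadj hconj s.1.2 w.2).symm)
  have heqv := (cycConj_of_isConj hrun).cycEqv
    (not_cycRed_of_closed x hf hadj hconj hc₁ hm₁) (not_cycRed_of_closed x hf hadj hconj hc₂ hm₂)
  obtain ⟨c, hc, hmatch⟩ := exists_forall₂_of_cycEqv x hadj hc₁ heqv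
    ⟨_, hm₁, forall₂_same.2 fun _ _ => .inl rfl⟩
  rw [← listMatch_iff x hf hadj hconj, hno c hc] at hmatch
  exact Bool.false_ne_true hmatch

/-- Both words are brought into closed lists. A match found in the first list is reached by
prolonging the first program, which gives a positive certificate; the absence of a match is itself
the refutation. -/
theorem exists_certificate (w : List (Syllable A ι) × List (Syllable A ι)) :
    ∃ s, (answer adj conj w s || refutes adj conj w s) = true := by
  obtain ⟨is, C, hC, hmem, hrun⟩ := exists_closed adj conj w.1
  obtain ⟨js, D, hD, hmem', -⟩ := exists_closed adj conj w.2
  by_cases h : ∃ c ∈ C, listMatch adj conj c (run adj conj js w.2) = true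
  · obtain ⟨c, hc, h⟩ := h
    obtain ⟨ks, rfl⟩ := hrun c hc
    refine ⟨((is ++ ks, js), C, D), Bool.or_eq_true_iff.2 (.inl ?_)⟩
    simpa [answer, run_append] using h
  · refine ⟨((is, js), C, D), Bool.or_eq_true_iff.2 (.inr ?_)⟩
    simpa [refutes, hC, hD, hmem, hmem'] using h

end Decision

end GraphProduct.Coded

/-! ### Solvability of the conjugacy problem for graph products -/

namespace GraphProduct

section

variable {V : Type*} (Γ : SimpleGraph V) {G : V → Type*} [∀ u, Group (G u)]

/-- Conjugacy in a graph product is decidable for words in the letters of finitely many vertex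
groups over whose alphabets conjugacy is decidable. -/
theorem conjugacyDecidable_of_injective {A ι : Type*} [Finite A] [Primcodable A] [Primcodable ι]
    {f : A → V} (hf : f.Injective) (x : ∀ a, ι → G (f a)) (hx : ∀ a, ConjugacyDecidable (x a)) :
    ConjugacyDecidable (fun p : A × ι => of Γ G (f p.1) (x p.1 p.2)) := by
  classical
  let adj : A → A → Bool := fun a b => decide (Γ.Adj (f a) (f b))
  let conj : A → List (ι × Bool) → List (ι × Bool) → Bool := fun a w w' =>
    decide (IsConj (wordValue (x a) w) (wordValue (x a) w'))
  have hadj : ∀ a b, adj a b = true ↔ Γ.Adj (f a) (f b) := fun a b => decide_eq_true_iff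
  have hconj : ∀ a w w', conj a w w' = true ↔
      IsConj (wordValue (x a) w) (wordValue (x a) w') := fun a w w' => decide_eq_true_iff
  have hcomp : Computable fun z : A × List (ι × Bool) × List (ι × Bool) =>
      conj z.1 z.2.1 z.2.2 := by
    refine Computable.of_finite_left (g := fun a (p : List (ι × Bool) × List (ι × Bool)) =>
      conj a p.1 p.2) fun a => ?_
    obtain ⟨_, h⟩ := hx a
    exact h.of_eq fun _ => decide_eq_decide.2 .rfl
  have hdec : ComputablePred fun w : List (Coded.Syllable A ι) × List (Coded.Syllable A ι) =>
      IsConj (syllableProd Γ (Coded.syllables x w.1)) (syllableProd Γ (Coded.syllables x w.2)) := by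
    refine ComputablePred.of_certificate
      (v := fun w s => Coded.answer adj conj w s || Coded.refutes adj conj w s)
      (r := Coded.answer adj conj)
      (Primrec.or.to_comp.comp (Coded.computable_answer adj hcomp)
        (Coded.computable_refutes adj hcomp))
      (Coded.computable_answer adj hcomp) Coded.exists_certificate fun w s hs => ?_
    refine ⟨Coded.isConj_of_answer x hf hadj hconj, fun hw => ?_⟩
    rcases Bool.or_eq_true_iff.1 hs with h | h
    · exact h
    · exact absurd hw (Coded.not_isConj_of_refutes x hf hadj hconj h)
  let enc : List ((A × ι) × Bool) → List (Coded.Syllable A ι) := fun w =>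
    w.map fun p => (p.1.1, [(p.1.2, p.2)])
  have henc : Primrec enc := by
    have h₁ : Primrec fun z : List ((A × ι) × Bool) × ((A × ι) × Bool) => z.2.1 :=
      Primrec.fst.comp Primrec.snd
    exact Primrec.list_map Primrec.id ((Primrec.fst.comp h₁).pair (Primrec.list_cons.comp
      ((Primrec.snd.comp h₁).pair (Primrec.snd.comp Primrec.snd)) (Primrec.const [])))
  have hval : ∀ w, syllableProd Γ (Coded.syllables x (enc w)) =
      wordValue (fun p : A × ι => of Γ G (f p.1) (x p.1 p.2)) w := by
    intro w
    induction w with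
    | nil => rfl
    | cons p w ih =>
      have h₁ : Coded.syllables x (enc (p :: w)) =
        ⟨f p.1.1, wordValue (x p.1.1) [(p.1.2, p.2)]⟩ :: Coded.syllables x (enc w) := rfl
      rw [h₁, syllableProd_cons, ih]
      rcases p with ⟨p, _ | _⟩ <;> simp [wordValue]
  refine ComputablePred.computable_of_manyOneReducible ⟨fun p => (enc p.1, enc p.2),
    ((henc.comp Primrec.fst).pair (henc.comp Primrec.snd)).to_comp, fun p => ?_⟩ hdec
  simp only [hval]

theorem hasSolvableConjugacyProblem (h : ∀ u, HasSolvableConjugacyProblem (G u)) :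
    HasSolvableConjugacyProblem (GraphProduct Γ G) := by
  classical
  intro n y
  choose l hl using fun k => exists_syllableProd (Γ := Γ) (y k)
  let T : List (Sigma G) := (List.ofFn l).flatten
  let S : Finset V := (T.map Sigma.fst).toFinset
  let f : Fin S.card → V := fun a => (S.equivFin.symm a : V)
  have hf : f.Injective := Subtype.val_injective.comp S.equivFin.symm.injective
  -- All vertices share the alphabet of positions in `T`. A position whose syllable lies at another
  -- vertex gets the harmless value `1`.
  let x : ∀ a, Fin T.length → G (f a) := fun a j =>
    if hj : (T.get j).1 = f a then hj ▸ (T.get j).2 else 1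
  refine (conjugacyDecidable_of_injective Γ hf x fun a => h _ _ (x a)).of_subset y fun k => ?_
  rw [← hl k]
  refine Subgroup.list_prod_mem _ fun g hg => ?_
  obtain ⟨z, hz, rfl⟩ := List.mem_map.1 hg
  have hzT : z ∈ T := List.mem_flatten.2 ⟨l k, by simp, hz⟩
  have hzS : z.1 ∈ S := List.mem_toFinset.2 (List.mem_map_of_mem hzT)
  obtain ⟨j, hj⟩ := List.mem_iff_get.1 hzT
  refine Subgroup.subset_closure ⟨(S.equivFin ⟨z.1, hzS⟩, j), ?_⟩
  have hfa : f (S.equivFin ⟨z.1, hzS⟩) = z.1 := by simp [f]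
  -- The vertex is generalized so that the transport along an equality of vertices can be
  -- eliminated.
  have key : ∀ (v : V) (hv : z.1 = v) (hj' : (T.get j).1 = v),
      of Γ G v (hj' ▸ (T.get j).2) = of Γ G z.1 z.2 := by
    rintro _ rfl hj'
    subst hj
    rfl
  have hj' : (T.get j).1 = f (S.equivFin ⟨z.1, hzS⟩) := by rw [hfa, hj]
  change of Γ G (f _) (x _ j) = _
  simp only [x, hj', dite_true]
  exact key _ hfa.symm hj'

theorem closure_range_of_eq_top {ι : Type*} (x : ∀ u, ι → G u)
    (hx : ∀ u, Subgroup.closure (Set.range (x u)) = ⊤) :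
    Subgroup.closure (Set.range fun p : V × ι => of Γ G p.1 (x p.1 p.2)) = ⊤ := by
  refine (Subgroup.eq_top_iff' _).2 fun g => ?_
  obtain ⟨l, rfl⟩ := exists_syllableProd g
  refine Subgroup.list_prod_mem _ fun z hz => ?_
  obtain ⟨⟨u, g⟩, -, rfl⟩ := List.mem_map.1 hz
  have hg : g ∈ Subgroup.closure (Set.range (x u)) := by simp [hx]
  have := Subgroup.mem_map_of_mem (of Γ G u) hg
  rw [MonoidHom.map_closure] at this
  refine Subgroup.closure_mono ?_ this
  rintro _ ⟨_, ⟨i, rfl⟩, rfl⟩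
  exact ⟨(u, i), rfl⟩

end

end GraphProduct

theorem mainTheorem10 {V : Type*} (Γ : SimpleGraph V) (G : V → Type*) [∀ u, Group (G u)] :
    ((∀ u, HasSolvableConjugacyProblem (G u)) →
      HasSolvableConjugacyProblem (GraphProduct Γ G)) ∧
    (∀ [Finite V] [Primcodable V] {ι : Type*} [Primcodable ι] (x : ∀ u, ι → G u),
      (∀ u, SolvableConjugacyProblemWrt (x u)) →
      SolvableConjugacyProblemWrt
        (fun p : V × ι => GraphProduct.of Γ G p.1 (x p.1 p.2))) := by
  refine ⟨GraphProduct.hasSolvableConjugacyProblem Γ, fun x hx => ⟨?_, ?_⟩⟩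
  · exact GraphProduct.closure_range_of_eq_top Γ x fun u => (hx u).1
  · exact GraphProduct.conjugacyDecidable_of_injective Γ (f := id) Function.injective_id x
      fun u => (hx u).2
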